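/- Let $(\overline{W},g,J)$ be a Bochner Kaehler manifold of complex dimension $m$ (real dimension $2m$): a smooth Riemannian manifold with a smooth almost complex structure $J$, $g(JX,JY)=g(X,Y)$, $\overline\nabla J=0$ for the Levi-Civita connection $\overline\nabla$, whose curvature tensor $\overline R(X,Y,Z,W)=g(\overline\nabla_X\overline\nabla_YZ-\overline\nabla_Y\overline\nabla_XZ-\overline\nabla_{[X,Y]}Z,\,W)$ is $$\begin{aligned}\overline R(X,Y,Z,W)={}&L(Y,Z)g(X,W)-L(X,Z)g(Y,W)+L(X,W)g(Y,Z)-L(Y,W)g(X,Z)\\&+M(Y,Z)g(JX,W)-M(X,Z)g(JY,W)+M(X,W)g(JY,Z)-M(Y,W)g(JX,Z)\\&-2M(X,Y)g(JZ,W)-2M(Z,W)g(JX,Y),\end{aligned}$$ where $L=\frac{1}{2m+4}\mathrm{Ric}-\frac{\rho}{2(2m+2)(2m+4)}g$, $M(Y,Z)=-L(Y,JZ)$, $\mathrm{Ric}$ is the Ricci tensor of $\overline W$ and $\rho=\operatorname{tr}_g\mathrm{Ric}$ its scalar curvature. Let $(W_T,g_T)$ and $(W_\perp,g_\perp)$ be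 smooth Riemannian manifolds, $q=\dim W_\perp$, let $f:W_T\to(0,\infty)$ be smooth, and let $W=W_T\times_fW_\perp$ be the product $W_T\times W_\perp$ with the warped product metric $g_T+f^2g_\perp$. Suppose that $W$ is isometrically immersed in $\overline W$ as a CR-warped product submanifold: the distribution $D=TW_T$ is invariant ($JD=D$) and the distribution $D^\perp=TW_\perp$ is anti-invariant ($JD^\perp\subset T^\perp W$). For $X,Y$ tangent to $W$ let $\omega(X,Y)$ be the second fundamental form (the normal part of $\overline\nabla_XY$) and let $\mathcal P_XY$ be the tangential part of $(\overline\nabla_XJ)Y$. Assume that $\mathcal P_{D^\perp}D\subset D$, i.e. $\mathcal P_ZX\in D$ for all $Z\in D^\perp$, $X\in D$. Then at every point of $W$ $$\|\omega\|^2\ \ge\ \|\mathcal P_{D^\perp}D\|^2+q\,\|\mathrm{grad}_D(\log f)\|^2 .$$ Here $\|\omega\|^2=\sum_{a,b}g(\omega(e_a,e_b),\omega(e_a,e_b))$ over an orthonormal basis $(e_a)$ of the tangent space of $W$, $\|\mathcal P_{D^\perp}D\|^2=\sum_{i,\alpha}\|\mathcal P_{Z_\alpha}X_i\|^2$ over orthonormal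 bases $(X_i)$ of $D$ and $(Z_\alpha)$ of $D^\perp$, and $\mathrm{grad}_D(\log f)$ is the gradient of $\log f$ along $D$, that is, on $(W_T,g_T)$. -/

import Mathlib

open scoped Manifold ContDiff Bundle

noncomputable section

namespace CRWarped

section Ambient

/-! ### Riemannian and Kaehler geometry of the ambient manifold -/

variable {E : Type*} [NormedAddCommGroup E] [NormedSpace ℝ E] [FiniteDimensional ℝ E]
  {H : Type*} [TopologicalSpace H] {I : ModelWithCorners ℝ E H}
  {M : Type*} [TopologicalSpace M] [ChartedSpace H M] [IsManifold I ∞ M]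

instance (x : M) : FiniteDimensional ℝ (TangentSpace I x) :=
  inferInstanceAs (FiniteDimensional ℝ E)

/-- The gradient of a real function `h`: the tangent vector dual to `dh` under the metric. -/
def grad [Bundle.RiemannianBundle (fun x : M => TangentSpace I x)] (h : M → ℝ) (x : M) :
    TangentSpace I x :=
  haveI : CompleteSpace (TangentSpace I x) := FiniteDimensional.complete ℝ _
  (InnerProductSpace.toDual ℝ (TangentSpace I x)).symm (mvfderiv I h x)

/-- `cov` is the Levi-Civita connection: it is compatible with the metric and torsion-free.
Here `cov Y x u` is `∇_u Y` at the point `x`. -/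
structure IsLeviCivita [Bundle.RiemannianBundle (fun x : M => TangentSpace I x)]
    (cov : CovariantDerivative I E (TangentSpace I : M → Type _)) : Prop where
  metric : ∀ (Y Z : Π x : M, TangentSpace I x) (x : M),
    MDifferentiableAt I I.tangent (fun y => (⟨y, Y y⟩ : TangentBundle I M)) x →
    MDifferentiableAt I I.tangent (fun y => (⟨y, Z y⟩ : TangentBundle I M)) x →
    ∀ u : TangentSpace I x, mvfderiv I (fun y => inner ℝ (Y y) (Z y)) x u
      = inner ℝ (cov Y x u) (Z x) + inner ℝ (Y x) (cov Z x u)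
  torsion_free : cov.torsion = 0

/-- The curvature tensor `R(u,v)w = ∇_u ∇_v w - ∇_v ∇_u w - ∇_[u,v] w` at `x`, computed with local
extensions of `u, v, w` to vector fields that are smooth near `x`. -/
def curvature (cov : CovariantDerivative I E (TangentSpace I : M → Type _)) (x : M)
    (u v w : TangentSpace I x) : TangentSpace I x :=
  let U : Π y : M, TangentSpace I y := FiberBundle.extend E u
  let V : Π y : M, TangentSpace I y := FiberBundle.extend E v
  let W : Π y : M, TangentSpace I y := FiberBundle.extend E w
  cov (fun y => cov W y (V y)) x u - cov (fun y => cov W y (U y)) x v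
    - cov W x (VectorField.mlieBracket I U V x)

/-- The covariant derivative of an endomorphism field: `(∇_u J) v = ∇_u (J V) - J (∇_u V)` at `x`,
where `V` is a local extension of `v` that is smooth near `x`. -/
def covDerivEnd (cov : CovariantDerivative I E (TangentSpace I : M → Type _))
    (J : Π x : M, TangentSpace I x →L[ℝ] TangentSpace I x) (x : M)
    (u v : TangentSpace I x) : TangentSpace I x :=
  let V : Π y : M, TangentSpace I y := FiberBundle.extend E v
  cov (fun y => J y (V y)) x u - J x (cov V x u)

variable [Bundle.RiemannianBundle (fun x : M => TangentSpace I x)]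

/-- The Ricci tensor `Ric(u,v) = ∑ g(R(e_i,u)v, e_i)` over an orthonormal basis. -/
def ricci (cov : CovariantDerivative I E (TangentSpace I : M → Type _)) (x : M)
    (u v : TangentSpace I x) : ℝ :=
  ∑ i, inner ℝ (curvature cov x (stdOrthonormalBasis ℝ (TangentSpace I x) i) u v)
    (stdOrthonormalBasis ℝ (TangentSpace I x) i)

/-- The scalar curvature: the full trace of the Ricci tensor. -/
def scalar (cov : CovariantDerivative I E (TangentSpace I : M → Type _)) (x : M) : ℝ :=
  ∑ i, ricci cov x (stdOrthonormalBasis ℝ (TangentSpace I x) i)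
    (stdOrthonormalBasis ℝ (TangentSpace I x) i)

/-- The tensor `L = Ric / (2m+4) - ρ g / (2(2m+2)(2m+4))`, `m` being the complex dimension. -/
def tensorL (m : ℕ) (cov : CovariantDerivative I E (TangentSpace I : M → Type _)) (x : M)
    (u v : TangentSpace I x) : ℝ :=
  ricci cov x u v / (2 * m + 4)
    - scalar cov x / (2 * (2 * m + 2) * (2 * m + 4)) * inner ℝ u v

/-- The tensor `M(u,v) = -L(u, Jv)`. -/
def tensorM (m : ℕ) (cov : CovariantDerivative I E (TangentSpace I : M → Type _))
    (J : Π x : M, TangentSpace I x →L[ℝ] TangentSpace I x) (x : M)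
    (u v : TangentSpace I x) : ℝ :=
  - tensorL m cov x u (J x v)

/-- `(M, g, J)` with Levi-Civita connection `cov` is a Kaehler manifold: `J` is a smooth almost
complex structure, `g` is Hermitian, and `J` is parallel. -/
structure IsKaehler
    (cov : CovariantDerivative I E (TangentSpace I : M → Type _))
    (J : Π x : M, TangentSpace I x →L[ℝ] TangentSpace I x) : Prop where
  leviCivita : IsLeviCivita cov
  smooth : ContMDiff I (I.prod 𝓘(ℝ, E →L[ℝ] E)) ∞
    (fun x => Bundle.TotalSpace.mk' (E →L[ℝ] E)
      (E := fun x : M => TangentSpace I x →L[ℝ] TangentSpace I x) x (J x))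
  sq : ∀ (x : M) (u : TangentSpace I x), J x (J x u) = -u
  hermitian : ∀ (x : M) (u v : TangentSpace I x), inner ℝ (J x u) (J x v) = inner ℝ u v
  parallel : ∀ (Y : Π x : M, TangentSpace I x) (x : M),
    MDifferentiableAt I I.tangent (fun y => (⟨y, Y y⟩ : TangentBundle I M)) x →
    ∀ u : TangentSpace I x, cov (fun y => J y (Y y)) x u = J x (cov Y x u)

/-- A Bochner Kaehler manifold of complex dimension `m`: a Kaehler manifold whose Bochner tensor
vanishes, that is, whose curvature tensor has the form below. -/
structure IsBochnerKaehler
    (m : ℕ) (cov : CovariantDerivative I E (TangentSpace I : M → Type _))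
    (J : Π x : M, TangentSpace I x →L[ℝ] TangentSpace I x) : Prop
    extends IsKaehler cov J where
  bochner : ∀ (x : M) (X Y Z W : TangentSpace I x),
    inner ℝ (curvature cov x X Y Z) W
      = tensorL m cov x Y Z * inner ℝ X W - tensorL m cov x X Z * inner ℝ Y W
      + tensorL m cov x X W * inner ℝ Y Z - tensorL m cov x Y W * inner ℝ X Z
      + tensorM m cov J x Y Z * inner ℝ (J x X) W - tensorM m cov J x X Z * inner ℝ (J x Y) W
      + tensorM m cov J x X W * inner ℝ (J x Y) Z - tensorM m cov J x Y W * inner ℝ (J x X) Z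
      - 2 * tensorM m cov J x X Y * inner ℝ (J x Z) W
      - 2 * tensorM m cov J x Z W * inner ℝ (J x X) Y

end Ambient

section Submanifold

/-! ### Immersed submanifolds `φ : N → M` -/

variable {E : Type*} [NormedAddCommGroup E] [NormedSpace ℝ E] [FiniteDimensional ℝ E]
  {H : Type*} [TopologicalSpace H] {I : ModelWithCorners ℝ E H}
  {M : Type*} [TopologicalSpace M] [ChartedSpace H M] [IsManifold I ∞ M]
  {F : Type*} [NormedAddCommGroup F] [NormedSpace ℝ F]
  {G : Type*} [TopologicalSpace G] (K : ModelWithCorners ℝ F G)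
  {N : Type*} [TopologicalSpace N] [ChartedSpace G N] [IsManifold K ∞ N]

/-- The covariant derivative `∇_u V` along `φ : N → M` of a vector field `V` along `φ`.
In the local frame of `TM` given by the preferred trivialization at `φ x`, write
`V = ∑ V^i (e_i ∘ φ)`; then `∇_u V = ∑ V^i(x) ∇_{dφ u} e_i + ∑ dV^i(u) e_i`. The first sum is the
ambient derivative of the extension of `V x` with constant components; the second one comes from
the derivative of the vector of components of `V`. -/
def covAlong (cov : CovariantDerivative I E (TangentSpace I : M → Type _)) (φ : N → M)
    (V : Π y : N, TangentSpace I (φ y)) (x : N) (u : TangentSpace K x) :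
    TangentSpace I (φ x) :=
  let t := trivializationAt E (TangentSpace I : M → Type _) (φ x)
  cov (FiberBundle.extend E (V x)) (φ x) (mfderiv K I φ x u)
    + t.symmL ℝ (φ x) (mvfderiv K (fun y => (t ⟨φ y, V y⟩).2) x u)

/-- The tangent space of the submanifold as a subspace of the ambient tangent space. -/
def tangentRange (I : ModelWithCorners ℝ E H) {M : Type*} [TopologicalSpace M] [ChartedSpace H M]
    (φ : N → M) (x : N) : Submodule ℝ (TangentSpace I (φ x)) :=
  LinearMap.range (mfderiv K I φ x).toLinearMap

variable [Bundle.RiemannianBundle (fun x : M => TangentSpace I x)]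

/-- The second fundamental form: `ω(u,v)` is the normal part of `∇_u (dφ V)`, where `V` is a local
extension of `v` to a vector field on `N` that is smooth near `x`. -/
def secondFundamentalForm (cov : CovariantDerivative I E (TangentSpace I : M → Type _))
    (φ : N → M) (x : N) (u v : TangentSpace K x) : TangentSpace I (φ x) :=
  (tangentRange K I φ x)ᗮ.starProjection
    (covAlong K cov φ (fun y => mfderiv K I φ y (FiberBundle.extend F v y)) x u)

/-- `P_u v`, the part of `(∇_u J) v` tangent to the submanifold, for `u, v` tangent to it. -/
def tangentialP (cov : CovariantDerivative I E (TangentSpace I : M → Type _))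
    (J : Π x : M, TangentSpace I x →L[ℝ] TangentSpace I x)
    (φ : N → M) (x : N) (u v : TangentSpace K x) : TangentSpace I (φ x) :=
  (tangentRange K I φ x).starProjection
    (covDerivEnd cov J (φ x) (mfderiv K I φ x u) (mfderiv K I φ x v))

end Submanifold

section Warped

/-! ### CR-warped products -/

variable {E : Type*} [NormedAddCommGroup E] [NormedSpace ℝ E] [FiniteDimensional ℝ E]
  {H : Type*} [TopologicalSpace H] {I : ModelWithCorners ℝ E H}
  {M : Type*} [TopologicalSpace M] [ChartedSpace H M] [IsManifold I ∞ M]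
  [Bundle.RiemannianBundle (fun x : M => TangentSpace I x)]
  {E₁ : Type*} [NormedAddCommGroup E₁] [NormedSpace ℝ E₁] [FiniteDimensional ℝ E₁]
  {H₁ : Type*} [TopologicalSpace H₁] (I₁ : ModelWithCorners ℝ E₁ H₁)
  {A : Type*} [TopologicalSpace A] [ChartedSpace H₁ A] [IsManifold I₁ ∞ A]
  {E₂ : Type*} [NormedAddCommGroup E₂] [NormedSpace ℝ E₂] [FiniteDimensional ℝ E₂]
  {H₂ : Type*} [TopologicalSpace H₂] (I₂ : ModelWithCorners ℝ E₂ H₂)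
  {B : Type*} [TopologicalSpace B] [ChartedSpace H₂ B] [IsManifold I₂ ∞ B]

/-- The tangent vector of `A × B` with components `u` along `A` and `v` along `B`. -/
def tangentPair (x : A × B) (u : TangentSpace I₁ x.1) (v : TangentSpace I₂ x.2) :
    TangentSpace (I₁.prod I₂) x :=
  ((u, v) : E₁ × E₂)

variable [Bundle.RiemannianBundle (fun x : A => TangentSpace I₁ x)]
  [Bundle.RiemannianBundle (fun x : B => TangentSpace I₂ x)]

/-- `φ : A × B → M` is a CR-warped product submanifold with warping function `f`: `f` is a positive
smooth function on `A`; `φ` is a smooth immersion which is isometric for the warped product metric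
`g_A + f² g_B` on `A × B`; the distribution `D = TA` is invariant under `J`, and `J` maps
`D^⊥ = TB` to normal vectors. -/
structure IsCRWarpedProduct (J : Π x : M, TangentSpace I x →L[ℝ] TangentSpace I x)
    (f : A → ℝ) (φ : A × B → M) : Prop where
  warp_pos : ∀ a, 0 < f a
  warp_smooth : ContMDiff I₁ 𝓘(ℝ, ℝ) ∞ f
  smooth : ContMDiff (I₁.prod I₂) I ∞ φ
  isometric : ∀ (x : A × B) (u u' : TangentSpace I₁ x.1) (v v' : TangentSpace I₂ x.2),
    inner ℝ (mfderiv (I₁.prod I₂) I φ x (tangentPair I₁ I₂ x u v))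
        (mfderiv (I₁.prod I₂) I φ x (tangentPair I₁ I₂ x u' v'))
      = inner ℝ u u' + f x.1 ^ 2 * inner ℝ v v'
  invariant : ∀ (x : A × B) (u : TangentSpace I₁ x.1), ∃ u' : TangentSpace I₁ x.1,
    J (φ x) (mfderiv (I₁.prod I₂) I φ x (tangentPair I₁ I₂ x u 0))
      = mfderiv (I₁.prod I₂) I φ x (tangentPair I₁ I₂ x u' 0)
  anti_invariant : ∀ (x : A × B) (v : TangentSpace I₂ x.2),
    J (φ x) (mfderiv (I₁.prod I₂) I φ x (tangentPair I₁ I₂ x 0 v))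
      ∈ (tangentRange (I₁.prod I₂) I φ x)ᗮ

/-- An orthonormal basis `X_i` of `D` at `x`, as tangent vectors of `A × B`. -/
def frameD (x : A × B) (i : Fin (Module.finrank ℝ (TangentSpace I₁ x.1))) :
    TangentSpace (I₁.prod I₂) x :=
  tangentPair I₁ I₂ x (stdOrthonormalBasis ℝ (TangentSpace I₁ x.1) i) 0

/-- An orthonormal basis `Z_α` of `D^⊥` at `x` for the warped product metric `g_A + f² g_B`. -/
def framePerp (f : A → ℝ) (x : A × B) (α : Fin (Module.finrank ℝ (TangentSpace I₂ x.2))) :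
    TangentSpace (I₁.prod I₂) x :=
  tangentPair I₁ I₂ x 0 ((f x.1)⁻¹ • stdOrthonormalBasis ℝ (TangentSpace I₂ x.2) α)

/-- The orthonormal basis `{X_i} ∪ {Z_α}` of the tangent space of the warped product at `x`. -/
def frame (f : A → ℝ) (x : A × B) :
    Fin (Module.finrank ℝ (TangentSpace I₁ x.1)) ⊕ Fin (Module.finrank ℝ (TangentSpace I₂ x.2)) →
      TangentSpace (I₁.prod I₂) x :=
  Sum.elim (frameD I₁ I₂ x) (framePerp I₁ I₂ f x)

/-- `‖ω‖² = ∑_{a,b} ‖ω(e_a, e_b)‖²` over an orthonormal basis of the tangent space. -/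
def normSqω (cov : CovariantDerivative I E (TangentSpace I : M → Type _))
    (f : A → ℝ) (φ : A × B → M) (x : A × B) : ℝ :=
  ∑ a, ∑ b, ‖secondFundamentalForm (I₁.prod I₂) cov φ x
    (frame I₁ I₂ f x a) (frame I₁ I₂ f x b)‖ ^ 2

/-- `‖P_{D^⊥} D‖² = ∑_{i,α} ‖P_{Z_α} X_i‖²` over orthonormal bases of `D` and `D^⊥`. -/
def normSqP (cov : CovariantDerivative I E (TangentSpace I : M → Type _))
    (J : Π x : M, TangentSpace I x →L[ℝ] TangentSpace I x)
    (f : A → ℝ) (φ : A × B → M) (x : A × B) : ℝ :=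
  ∑ i, ∑ α, ‖tangentialP (I₁.prod I₂) cov J φ x
    (framePerp I₁ I₂ f x α) (frameD I₁ I₂ x i)‖ ^ 2

/-- The condition `P_{D^⊥} D ⊂ D`: for `Z ∈ D^⊥` and `X ∈ D`, the vector `P_Z X` lies in `D`. -/
def PMapsIntoD (cov : CovariantDerivative I E (TangentSpace I : M → Type _))
    (J : Π x : M, TangentSpace I x →L[ℝ] TangentSpace I x) (φ : A × B → M) : Prop :=
  ∀ (x : A × B) (u : TangentSpace I₁ x.1) (v : TangentSpace I₂ x.2),
    ∃ u' : TangentSpace I₁ x.1,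
      tangentialP (I₁.prod I₂) cov J φ x (tangentPair I₁ I₂ x 0 v) (tangentPair I₁ I₂ x u 0)
        = mfderiv (I₁.prod I₂) I φ x (tangentPair I₁ I₂ x u' 0)

end Warped

end CRWarped

end

/-! On a Kaehler manifold `J` is parallel, so `P` vanishes identically (`IsKaehler.normSqP_eq_zero`)
and what remains is `‖ω‖² ≥ q ‖grad log f‖²`. The mixed components of `ω` already give this. Let `X
∈ D` and `Z ∈ D^⊥`. The warped metric forces `g(∇_Z Z, X) = -(X log f) g(Z, Z)`
(`inner_covMfderiv_perp_perp`). Differentiating `g(X, JZ) = 0` along `Z` and moving `J` past `∇`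
turns this into `g(ω(Z, X), JZ) = -(JX log f) g(Z, Z)` (`inner_covMfderiv_perp_left`). For a unit
`Z` the vector `JZ` is a unit normal, so Cauchy-Schwarz gives `‖ω(Z, X)‖² ≥ (JX log f)²`
(`sq_inner_grad_le`). As `X` runs over an orthonormal basis of `D`, so does `JX`; the sum over `X`
is `‖grad log f‖²`, once for each of the `q` vectors `Z`.

The longer part of the proof is the calculus of `covAlong` behind these differentiations: metric
compatibility, commutation with `J`, and the symmetry `∇_U (dφ V) = ∇_V (dφ U)` for coordinate
fields. The first two follow from a Leibniz expansion in ambient fields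
(`covAlong_eq_of_eventually_eq_sum`), the third from symmetric Christoffel symbols and symmetric
second derivatives (`covAlong_mfderiv_extend_comm`). -/

noncomputable section

namespace CRWarped

/-! ### Constant-component frames and the connection in them. -/

section AlongMaps

set_option linter.unusedSectionVars false

open Filter Topology

variable {E : Type*} [NormedAddCommGroup E] [NormedSpace ℝ E] [FiniteDimensional ℝ E]
  {H : Type*} [TopologicalSpace H] {I : ModelWithCorners ℝ E H}
  {M : Type*} [TopologicalSpace M] [ChartedSpace H M] [IsManifold I ∞ M]

/-- The local vector field with constant components `c` in the preferred trivialization at `p`. -/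
def constField (I : ModelWithCorners ℝ E H) {M : Type*} [TopologicalSpace M] [ChartedSpace H M]
    [IsManifold I ∞ M] (p : M) (c : E) (y : M) : TangentSpace I y :=
  (trivializationAt E (TangentSpace I : M → Type _) p).symmL ℝ y c

lemma snd_constField {p y : M} (c : E)
    (hy : y ∈ (trivializationAt E (TangentSpace I : M → Type _) p).baseSet) :
    (trivializationAt E (TangentSpace I : M → Type _) p ⟨y, constField I p c y⟩).2 = c := by
  have := (trivializationAt E (TangentSpace I : M → Type _) p).continuousLinearMapAt_symmL
    (R := ℝ) hy c
  rwa [Bundle.Trivialization.continuousLinearMapAt_apply,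
    Bundle.Trivialization.linearMapAt_apply, if_pos hy] at this

lemma constField_snd {p y : M} (w : TangentSpace I y)
    (hy : y ∈ (trivializationAt E (TangentSpace I : M → Type _) p).baseSet) :
    constField I p (trivializationAt E (TangentSpace I : M → Type _) p ⟨y, w⟩).2 y = w := by
  have := (trivializationAt E (TangentSpace I : M → Type _) p).symmL_continuousLinearMapAt
    (R := ℝ) hy w
  rwa [Bundle.Trivialization.continuousLinearMapAt_apply,
    Bundle.Trivialization.linearMapAt_apply, if_pos hy] at this

lemma mem_baseSet_self (p : M) :
    p ∈ (trivializationAt E (TangentSpace I : M → Type _) p).baseSet :=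
  FiberBundle.mem_baseSet_trivializationAt' p

lemma extend_eq_constField {p y : M} (w : TangentSpace I p)
    (hy : y ∈ (trivializationAt E (TangentSpace I : M → Type _) p).baseSet) :
    (FiberBundle.extend E w y : TangentSpace I y) =
      constField I p (trivializationAt E (TangentSpace I : M → Type _) p ⟨p, w⟩).2 y :=
  ((trivializationAt E (TangentSpace I : M → Type _) p).symmL_apply (R := ℝ) hy _).symm

lemma extend_eventuallyEq_constField {p : M} (w : TangentSpace I p) :
    ∀ᶠ y in 𝓝 p, (FiberBundle.extend E w y : TangentSpace I y) =
      constField I p (trivializationAt E (TangentSpace I : M → Type _) p ⟨p, w⟩).2 y :=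
  mem_of_superset ((trivializationAt E (TangentSpace I : M → Type _) p).open_baseSet.mem_nhds
    (mem_baseSet_self p)) fun _ hy => extend_eq_constField w hy

lemma mdifferentiableAt_constField (p : M) (c : E) :
    MDifferentiableAt I I.tangent
      (fun y => (⟨y, constField I p c y⟩ : TangentBundle I M)) p := by
  refine (FiberBundle.mdifferentiableAt_extend I E (constField I p c p)).congr_of_eventuallyEq ?_
  filter_upwards [extend_eventuallyEq_constField (constField I p c p)] with y hy
  rw [hy, snd_constField c (mem_baseSet_self p)]

/-- A connection is local, and the two fields agree near `p`. The form on the right is linear in the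
component vector, which makes the first term of `covAlong` computable. -/
lemma cov_extend (cov : CovariantDerivative I E (TangentSpace I : M → Type _)) {p : M}
    (w : TangentSpace I p) :
    cov (FiberBundle.extend E w) p =
      cov (constField I p (trivializationAt E (TangentSpace I : M → Type _) p ⟨p, w⟩).2) p :=
  cov.isCovariantDerivativeOnUniv.congr_of_eventuallyEq
    (FiberBundle.mdifferentiableAt_extend I E w) (mdifferentiableAt_constField p _) univ_mem
    (extend_eventuallyEq_constField w)

lemma constField_sum {ι : Type*} (s : Finset ι) (p y : M) (a : ι → ℝ) (c : ι → E) :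
    constField I p (∑ i ∈ s, a i • c i) y = ∑ i ∈ s, a i • constField I p (c i) y := by
  simp [constField]

/-- The frame expansion of a tangent vector over the domain of a trivialization. -/
lemma eq_sum_constField {ι : Type*} [Fintype ι] (b : Module.Basis ι ℝ E) {p y : M}
    (w : TangentSpace I y)
    (hy : y ∈ (trivializationAt E (TangentSpace I : M → Type _) p).baseSet) :
    w = ∑ j, b.repr (trivializationAt E (TangentSpace I : M → Type _) p ⟨y, w⟩).2 j •
      constField I p (b j) y := by
  rw [← constField_sum, b.sum_repr, constField_snd w hy]

/-- Differentiability and the Leibniz formula are proved together because additivity of `cov` in the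
induction step needs the partial sum to be differentiable. -/
lemma cov_sum_smul (cov : CovariantDerivative I E (TangentSpace I : M → Type _))
    {ι : Type*} (s : Finset ι) (h : ι → M → ℝ) (S : ι → Π y : M, TangentSpace I y) (p : M)
    (hh : ∀ i ∈ s, MDifferentiableAt I 𝓘(ℝ, ℝ) (h i) p)
    (hS : ∀ i ∈ s, MDifferentiableAt I I.tangent
      (fun y => (⟨y, S i y⟩ : TangentBundle I M)) p) (w : TangentSpace I p) :
    MDifferentiableAt I I.tangent
      (fun y => (⟨y, ∑ i ∈ s, h i y • S i y⟩ : TangentBundle I M)) p ∧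
    cov (fun y => ∑ i ∈ s, h i y • S i y) p w =
      ∑ i ∈ s, (h i p • cov (S i) p w + mvfderiv I (h i) p w • S i p) := by
  classical
  induction s using Finset.induction_on with
  | empty =>
    refine ⟨?_, ?_⟩
    · simpa using! (Bundle.mdifferentiableAt_zeroSection ℝ (TangentSpace I : M → Type _) (x := p))
    · rw [show (fun y => ∑ i ∈ (∅ : Finset ι), h i y • S i y) =
        (0 : Π y : M, TangentSpace I y) from funext fun y => Finset.sum_empty, cov.zero]
      rfl
  | insert i s hi ih =>
    obtain ⟨ih₁, ih₂⟩ := ih (fun j hj => hh j (Finset.mem_insert_of_mem hj))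
      (fun j hj => hS j (Finset.mem_insert_of_mem hj))
    have h₁ := hh i (Finset.mem_insert_self i s)
    have h₂ := hS i (Finset.mem_insert_self i s)
    have h₃ : MDifferentiableAt I I.tangent
      (fun y => (⟨y, (h i • S i) y⟩ : TangentBundle I M)) p := h₁.smul_section h₂
    have e : (fun y => ∑ j ∈ insert i s, h j y • S j y) =
        (h i • S i : Π y : M, TangentSpace I y) + fun y => ∑ j ∈ s, h j y • S j y := by
      funext y
      simp [Finset.sum_insert hi]
    refine ⟨?_, ?_⟩
    · have := mdifferentiableAt_add_section h₃ ih₁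
      rw [← e] at this
      exact this
    · rw [e, cov.isCovariantDerivativeOnUniv.add h₃ ih₁, Finset.sum_insert hi,
        add_apply, ih₂, cov.isCovariantDerivativeOnUniv.leibniz h₂ h₁]
      simp

variable {F : Type*} [NormedAddCommGroup F] [NormedSpace ℝ F]
  {G : Type*} [TopologicalSpace G] {K : ModelWithCorners ℝ F G}
  {N : Type*} [TopologicalSpace N] [ChartedSpace G N] [IsManifold K ∞ N]

omit [IsManifold K ∞ N] in
lemma mvfderiv_eq_of_hasMFDerivAt {X : Type*} [NormedAddCommGroup X] [NormedSpace ℝ X]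
    {h : N → X} {x : N} {D : TangentSpace K x →L[ℝ] X} (hD : HasMFDerivAt K 𝓘(ℝ, X) h x D) :
    mvfderiv K h x = D := by
  ext u
  change mfderiv K 𝓘(ℝ, X) h x u = D u
  rw [hD.mfderiv]
  rfl

lemma cov_constField_sum (cov : CovariantDerivative I E (TangentSpace I : M → Type _))
    {ι : Type*} (s : Finset ι) (p : M) (a : ι → ℝ) (c : ι → E) (w : TangentSpace I p) :
    cov (constField I p (∑ i ∈ s, a i • c i)) p w =
      ∑ i ∈ s, a i • cov (constField I p (c i)) p w := by
  have := (cov_sum_smul cov s (fun i _ => a i) (fun i => constField I p (c i)) p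
    (fun i _ => mdifferentiableAt_const) (fun i _ => mdifferentiableAt_constField p _) w).2
  simp only [mvfderiv_const] at this
  rw [show constField I p (∑ i ∈ s, a i • c i) =
    fun y => ∑ i ∈ s, a i • constField I p (c i) y from funext fun y => constField_sum s p y a c,
    this]
  simp

/-- The components of `V` near `x` are `∑ h i • c i`, so the second term of `covAlong`
differentiates only the `h i`. The vectors `c i` need not be independent or distinct, so sums
indexed by pairs are covered as well. -/
lemma covAlong_eq_of_eventually_eq_sum_constField
    (cov : CovariantDerivative I E (TangentSpace I : M → Type _)) {φ : N → M}
    {V : Π y : N, TangentSpace I (φ y)} {x : N} {ι : Type*} (s : Finset ι)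
    (h : ι → N → ℝ) (c : ι → E) (hφ : ContinuousAt φ x)
    (hh : ∀ i ∈ s, MDifferentiableAt K 𝓘(ℝ, ℝ) (h i) x)
    (hV : ∀ᶠ y in 𝓝 x, V y = ∑ i ∈ s, h i y • constField I (φ x) (c i) (φ y))
    (u : TangentSpace K x) :
    covAlong K cov φ V x u =
      ∑ i ∈ s, (h i x • cov (constField I (φ x) (c i)) (φ x) (mfderiv K I φ x u)
        + mvfderiv K (h i) x u • constField I (φ x) (c i) (φ x)) := by
  classical
  have hbase : ∀ᶠ y in 𝓝 x,
      φ y ∈ (trivializationAt E (TangentSpace I : M → Type _) (φ x)).baseSet :=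
    hφ.eventually ((trivializationAt E (TangentSpace I : M → Type _) (φ x)).open_baseSet.mem_nhds
      (mem_baseSet_self _))
  have hcomp : (fun y => (trivializationAt E (TangentSpace I : M → Type _) (φ x)
      ⟨φ y, V y⟩).2) =ᶠ[𝓝 x] fun y => ∑ i ∈ s, h i y • c i := by
    filter_upwards [hbase, hV] with y hy hVy
    rw [hVy, ← constField_sum, snd_constField _ hy]
  have hd : ∀ (s' : Finset ι), s' ⊆ s →
      HasMFDerivAt K 𝓘(ℝ, E) (fun y => ∑ i ∈ s', h i y • c i) x
        (∑ i ∈ s', (mvfderiv K (h i) x).smulRight (c i) : TangentSpace K x →L[ℝ] E) := by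
    intro s'
    induction s' using Finset.induction_on with
    | empty => intro _; simpa using! hasMFDerivAt_const (I := K) (I' := 𝓘(ℝ, E)) (0 : E) x
    | insert i s' hi ih =>
      intro hs
      have h₁ := ih (fun j hj => hs (Finset.mem_insert_of_mem hj))
      have h₂ := (hh i (hs (Finset.mem_insert_self i s'))).hasMFDerivAt
      have h₃ : HasMFDerivAt K 𝓘(ℝ, E) (fun y => h i y • c i) x
          ((mvfderiv K (h i) x).smulRight (c i) : TangentSpace K x →L[ℝ] E) := by
        refine ⟨h₂.1.smul continuousAt_const, ?_⟩
        exact h₂.2.smul_const (c i)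
      have h₄ := h₃.add h₁
      rw [Finset.sum_insert hi]
      refine h₄.congr_of_eventuallyEq (Eventually.of_forall fun y => ?_)
      simp [Finset.sum_insert hi]
  have hm : mvfderiv K (fun y => (trivializationAt E (TangentSpace I : M → Type _) (φ x)
      ⟨φ y, V y⟩).2) x u = ∑ i ∈ s, mvfderiv K (h i) x u • c i := by
    rw [mvfderiv_eq_of_hasMFDerivAt ((hd s subset_rfl).congr_of_eventuallyEq hcomp)]
    simp
  have hVx := hV.self_of_nhds
  rw [← constField_sum] at hVx
  unfold covAlong
  simp only
  rw [hVx, cov_extend, snd_constField _ (mem_baseSet_self _), cov_constField_sum, Finset.sum_add_distrib, hm]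
  congr 1
  exact constField_sum s _ _ _ _

end AlongMaps

/-! ### Leibniz rule, metric compatibility and `J`-linearity along a map. -/

section AlongMaps

set_option linter.unusedSectionVars false

open Filter Topology

variable {E : Type*} [NormedAddCommGroup E] [NormedSpace ℝ E] [FiniteDimensional ℝ E]
  {H : Type*} [TopologicalSpace H] {I : ModelWithCorners ℝ E H}
  {M : Type*} [TopologicalSpace M] [ChartedSpace H M] [IsManifold I ∞ M]
  {F : Type*} [NormedAddCommGroup F] [NormedSpace ℝ F]
  {G : Type*} [TopologicalSpace G] {K : ModelWithCorners ℝ F G}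
  {N : Type*} [TopologicalSpace N] [ChartedSpace G N] [IsManifold K ∞ N]

/-- A vector field along `φ` that is differentiable at `x` has differentiable components in the
frame of constant fields at `φ x`. -/
lemma exists_eventually_eq_sum_constField {ι : Type*} [Fintype ι] (b : Module.Basis ι ℝ E)
    {φ : N → M} {V : Π y : N, TangentSpace I (φ y)} {x : N}
    (hV : MDifferentiableAt K I.tangent (fun y => (⟨φ y, V y⟩ : TangentBundle I M)) x) :
    ∃ h : ι → N → ℝ, (∀ i, MDifferentiableAt K 𝓘(ℝ, ℝ) (h i) x) ∧
      ∀ᶠ y in 𝓝 x, V y = ∑ i, h i y • constField I (φ x) (b i) (φ y) := by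
  have hV' := hV
  rw [mdifferentiableAt_totalSpace] at hV'
  obtain ⟨hφ, hv⟩ := hV'
  refine ⟨fun i y => b.repr (trivializationAt E (TangentSpace I : M → Type _) (φ x)
    ⟨φ y, V y⟩).2 i, fun i => ?_, ?_⟩
  · have hc : MDifferentiableAt 𝓘(ℝ, E) 𝓘(ℝ, ℝ) (fun c : E => b.repr c i)
        (trivializationAt E (TangentSpace I : M → Type _) (φ x) ⟨φ x, V x⟩).2 :=
      (LinearMap.toContinuousLinearMap (b.coord i)).differentiableAt.mdifferentiableAt
    exact hc.comp x hv
  · have hbase : ∀ᶠ y in 𝓝 x,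
        φ y ∈ (trivializationAt E (TangentSpace I : M → Type _) (φ x)).baseSet :=
      hφ.continuousAt.eventually
        ((trivializationAt E (TangentSpace I : M → Type _) (φ x)).open_baseSet.mem_nhds
          (mem_baseSet_self _))
    filter_upwards [hbase] with y hy
    exact eq_sum_constField b (V y) hy

/-- Expansion of the covariant derivative along `φ` in terms of ambient vector fields. -/
lemma covAlong_eq_of_eventually_eq_sum
    (cov : CovariantDerivative I E (TangentSpace I : M → Type _)) {φ : N → M}
    {V : Π y : N, TangentSpace I (φ y)} {x : N} {ι : Type*} (s : Finset ι)
    (h : ι → N → ℝ) (S : ι → Π y : M, TangentSpace I y)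
    (hφ : MDifferentiableAt K I φ x)
    (hh : ∀ i ∈ s, MDifferentiableAt K 𝓘(ℝ, ℝ) (h i) x)
    (hS : ∀ i, MDifferentiableAt I I.tangent
      (fun y => (⟨y, S i y⟩ : TangentBundle I M)) (φ x))
    (hV : ∀ᶠ y in 𝓝 x, V y = ∑ i ∈ s, h i y • S i (φ y))
    (u : TangentSpace K x) :
    covAlong K cov φ V x u =
      ∑ i ∈ s, (h i x • cov (S i) (φ x) (mfderiv K I φ x u)
        + mvfderiv K (h i) x u • S i (φ x)) := by
  classical
  let b := Module.finBasis ℝ E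
  choose g hg hSg using fun i => exists_eventually_eq_sum_constField (K := I) (φ := fun y : M => y)
    b (hS i)
  have hgφ : ∀ i j, MDifferentiableAt K 𝓘(ℝ, ℝ) (fun y => g i j (φ y)) x :=
    fun i j => (hg i j).comp x hφ
  have hV' : ∀ᶠ y in 𝓝 x, V y = ∑ z ∈ s ×ˢ Finset.univ,
      (h z.1 y * g z.1 z.2 (φ y)) • constField I (φ x) (b z.2) (φ y) := by
    have : ∀ᶠ y in 𝓝 x, ∀ i ∈ s,
        S i (φ y) = ∑ j, g i j (φ y) • constField I (φ x) (b j) (φ y) :=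
      (eventually_all_finset s).2 fun i _ => hφ.continuousAt.eventually (hSg i)
    filter_upwards [hV, this] with y hy hy'
    rw [hy, Finset.sum_product]
    refine Finset.sum_congr rfl fun i hi => ?_
    rw [hy' i hi, Finset.smul_sum]
    exact Finset.sum_congr rfl fun j _ => smul_smul _ _ _
  -- Each `S i` is expanded in the frame, so `V` becomes a sum over pairs `(i, j)` in which every
  -- basis vector `b j` is repeated.
  rw [covAlong_eq_of_eventually_eq_sum_constField cov (s ×ˢ Finset.univ)
    (fun z y => h z.1 y * g z.1 z.2 (φ y)) (fun z => b z.2) hφ.continuousAt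
    (fun z hz => (hh z.1 (Finset.mem_product.1 hz).1).mul (hgφ z.1 z.2)) hV' u,
    Finset.sum_product]
  refine Finset.sum_congr rfl fun i hi => ?_
  obtain ⟨hm, hc⟩ := cov_sum_smul cov Finset.univ (g i) (fun j => constField I (φ x) (b j)) (φ x)
    (fun j _ => hg i j) (fun j _ => mdifferentiableAt_constField _ _) (mfderiv K I φ x u)
  have hcov : cov (S i) (φ x) (mfderiv K I φ x u) = _ :=
    (congrArg (fun D => D (mfderiv K I φ x u))
      (cov.isCovariantDerivativeOnUniv.congr_of_eventuallyEq (hS i) hm univ_mem (hSg i))).trans hc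
  have hSx : S i (φ x) = _ := (hSg i).self_of_nhds
  rw [hcov]
  conv_rhs => rw [hSx]
  rw [Finset.smul_sum, Finset.smul_sum, ← Finset.sum_add_distrib]
  refine Finset.sum_congr rfl fun j _ => ?_
  -- The chain rule turns the derivative of `g i j ∘ φ` along `u` into that of `g i j` along `dφ u`,
  -- which is the term in the ambient Leibniz formula for `S i`.
  have hprod : mvfderiv K (fun y => h i y * g i j (φ y)) x u
      = h i x * mvfderiv I (g i j) (φ x) (mfderiv K I φ x u)
        + g i j (φ x) * mvfderiv K (h i) x u := by
    rw [mvfderiv_fun_mul (hh i hi) (hgφ i j)]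
    have := mvfderiv_comp_apply x (hg i j) hφ u
    simp only [add_apply, smul_apply, smul_eq_mul]
    rw [← this]
    rfl
  rw [hprod]
  module

lemma mdifferentiableAt_inner [Bundle.RiemannianBundle (fun x : M => TangentSpace I x)]
    [IsContMDiffRiemannianBundle I ∞ E (fun x : M => TangentSpace I x)]
    {φ : N → M} {V W : Π y : N, TangentSpace I (φ y)} {x : N}
    (hV : MDifferentiableAt K I.tangent (fun y => (⟨φ y, V y⟩ : TangentBundle I M)) x)
    (hW : MDifferentiableAt K I.tangent (fun y => (⟨φ y, W y⟩ : TangentBundle I M)) x) :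
    MDifferentiableAt K 𝓘(ℝ, ℝ) (fun y => inner ℝ (V y) (W y)) x :=
  MDifferentiableAt.inner_bundle (IB := I) (F := E) (E := fun x : M => TangentSpace I x) hV hW

/-- The covariant derivative along a map is compatible with the metric. -/
lemma IsLeviCivita.mvfderiv_inner_along
    [Bundle.RiemannianBundle (fun x : M => TangentSpace I x)]
    [IsContMDiffRiemannianBundle I ∞ E (fun x : M => TangentSpace I x)]
    {cov : CovariantDerivative I E (TangentSpace I : M → Type _)} (hcov : IsLeviCivita cov)
    {φ : N → M} {V W : Π y : N, TangentSpace I (φ y)} {x : N}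
    (hV : MDifferentiableAt K I.tangent (fun y => (⟨φ y, V y⟩ : TangentBundle I M)) x)
    (hW : MDifferentiableAt K I.tangent (fun y => (⟨φ y, W y⟩ : TangentBundle I M)) x)
    (u : TangentSpace K x) :
    mvfderiv K (fun y => inner ℝ (V y) (W y)) x u =
      inner ℝ (covAlong K cov φ V x u) (W x) + inner ℝ (V x) (covAlong K cov φ W x u) := by
  classical
  let b := Module.finBasis ℝ E
  have hφ : MDifferentiableAt K I φ x := by
    rw [mdifferentiableAt_totalSpace] at hV
    exact hV.1
  obtain ⟨v, hv, hVv⟩ := exists_eventually_eq_sum_constField b hV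
  obtain ⟨w, hw, hWw⟩ := exists_eventually_eq_sum_constField b hW
  set e := fun i => constField I (φ x) (b i) with he
  have hes : ∀ i, MDifferentiableAt I I.tangent
      (fun y => (⟨y, e i y⟩ : TangentBundle I M)) (φ x) :=
    fun i => mdifferentiableAt_constField _ _
  have hg : ∀ i j, MDifferentiableAt I 𝓘(ℝ, ℝ) (fun y => inner ℝ (e i y) (e j y)) (φ x) :=
    fun i j => mdifferentiableAt_inner (φ := fun y : M => y) (hes i) (hes j)
  have hgφ : ∀ i j, MDifferentiableAt K 𝓘(ℝ, ℝ) (fun y => inner ℝ (e i (φ y)) (e j (φ y))) x :=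
    fun i j => (hg i j).comp x hφ
  -- Ambient metric compatibility enters only here, for the frame fields; the rest is the product
  -- rule for `v i * w j * g(e i, e j)`.
  have hdg : ∀ i j, mvfderiv K (fun y => inner ℝ (e i (φ y)) (e j (φ y))) x u
      = inner ℝ (cov (e i) (φ x) (mfderiv K I φ x u)) (e j (φ x))
        + inner ℝ (e i (φ x)) (cov (e j) (φ x) (mfderiv K I φ x u)) := fun i j => by
    rw [← hcov.metric _ _ _ (hes i) (hes j)]
    exact mvfderiv_comp_apply x (hg i j) hφ u
  have hterm : ∀ i j, HasMFDerivAt K 𝓘(ℝ, ℝ)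
      (fun y => (v i y * w j y) * inner ℝ (e i (φ y)) (e j (φ y))) x
      (mvfderiv K (fun y => (v i y * w j y) * inner ℝ (e i (φ y)) (e j (φ y))) x) :=
    fun i j => (((hv i).mul (hw j)).mul (hgφ i j)).hasMFDerivAt
  have hsum : HasMFDerivAt K 𝓘(ℝ, ℝ)
      (fun y => ∑ z : _ × _, (v z.1 y * w z.2 y) * inner ℝ (e z.1 (φ y)) (e z.2 (φ y))) x
      (∑ z : _ × _,
        mvfderiv K (fun y => (v z.1 y * w z.2 y) * inner ℝ (e z.1 (φ y)) (e z.2 (φ y))) x :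
          TangentSpace K x →L[ℝ] ℝ) := by
    have := HasMFDerivAt.sum (t := Finset.univ) fun (z : _ × _) _ => hterm z.1 z.2
    refine this.congr_of_eventuallyEq (Eventually.of_forall fun y => ?_)
    simp
  have hexp : (fun y => inner ℝ (V y) (W y)) =ᶠ[𝓝 x]
      fun y => ∑ z : _ × _, (v z.1 y * w z.2 y) * inner ℝ (e z.1 (φ y)) (e z.2 (φ y)) := by
    filter_upwards [hVv, hWw] with y hy hy'
    rw [hy, hy', Fintype.sum_prod_type, sum_inner]
    refine Finset.sum_congr rfl fun i _ => ?_
    rw [inner_sum]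
    refine Finset.sum_congr rfl fun j _ => ?_
    rw [real_inner_smul_left, real_inner_smul_right, mul_assoc]
  have hVx : V x = ∑ i, v i x • e i (φ x) := hVv.self_of_nhds
  have hWx : W x = ∑ i, w i x • e i (φ x) := hWw.self_of_nhds
  rw [mvfderiv_eq_of_hasMFDerivAt (hsum.congr_of_eventuallyEq hexp),
    covAlong_eq_of_eventually_eq_sum cov Finset.univ v e hφ (fun i _ => hv i) hes hVv,
    covAlong_eq_of_eventually_eq_sum cov Finset.univ w e hφ (fun i _ => hw i) hes hWw,
    hVx, hWx, sum_apply, Fintype.sum_prod_type, sum_inner, sum_inner,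
    ← Finset.sum_add_distrib]
  refine Finset.sum_congr rfl fun i _ => ?_
  rw [inner_sum, inner_sum, ← Finset.sum_add_distrib]
  refine Finset.sum_congr rfl fun j _ => ?_
  have hvw : MDifferentiableAt K 𝓘(ℝ, ℝ) (fun y => v i y * w j y) x := (hv i).mul (hw j)
  rw [mvfderiv_fun_mul hvw (hgφ i j), mvfderiv_fun_mul (hv i) (hw j)]
  simp only [add_apply, smul_apply, smul_eq_mul, hdg, inner_add_left, inner_add_right,
    real_inner_smul_left, real_inner_smul_right, smul_add]
  ring

/-- A parallel endomorphism field commutes with the covariant derivative along a map. -/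
lemma IsKaehler.covAlong_comp
    [Bundle.RiemannianBundle (fun x : M => TangentSpace I x)]
    {cov : CovariantDerivative I E (TangentSpace I : M → Type _)}
    {J : Π x : M, TangentSpace I x →L[ℝ] TangentSpace I x} (hJ : IsKaehler cov J)
    {φ : N → M} {V : Π y : N, TangentSpace I (φ y)} {x : N}
    (hV : MDifferentiableAt K I.tangent (fun y => (⟨φ y, V y⟩ : TangentBundle I M)) x)
    (u : TangentSpace K x) :
    covAlong K cov φ (fun y => J (φ y) (V y)) x u = J (φ x) (covAlong K cov φ V x u) := by
  let b := Module.finBasis ℝ E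
  have hφ : MDifferentiableAt K I φ x := by
    rw [mdifferentiableAt_totalSpace] at hV
    exact hV.1
  obtain ⟨v, hv, hVv⟩ := exists_eventually_eq_sum_constField b hV
  have hes : ∀ i, MDifferentiableAt I I.tangent
      (fun y => (⟨y, constField I (φ x) (b i) y⟩ : TangentBundle I M)) (φ x) :=
    fun i => mdifferentiableAt_constField _ _
  have hJe : ∀ i, MDifferentiableAt I I.tangent
      (fun y => (⟨y, J y (constField I (φ x) (b i) y)⟩ : TangentBundle I M)) (φ x) :=
    fun i => MDifferentiableAt.clm_bundle_apply
      ((hJ.smooth (φ x)).mdifferentiableAt (by simp)) (hes i)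
  have hJV : ∀ᶠ y in 𝓝 x, J (φ y) (V y) =
      ∑ i, v i y • J (φ y) (constField I (φ x) (b i) (φ y)) := by
    filter_upwards [hVv] with y hy
    simp [hy]
  -- The fields `J e_i` do not have constant components, hence the expansion in arbitrary ambient
  -- fields. Both sides have the same coefficients `v i`, so it suffices that `J` is parallel on
  -- each `e_i`.
  rw [covAlong_eq_of_eventually_eq_sum cov Finset.univ v _ hφ (fun i _ => hv i) hes hVv,
    covAlong_eq_of_eventually_eq_sum cov Finset.univ v
      (fun i y => J y (constField I (φ x) (b i) y)) hφ (fun i _ => hv i) hJe hJV, map_sum]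
  refine Finset.sum_congr rfl fun i _ => ?_
  rw [hJ.parallel _ _ (hes i)]
  simp

lemma IsKaehler.mdifferentiableAt_comp
    [Bundle.RiemannianBundle (fun x : M => TangentSpace I x)]
    {cov : CovariantDerivative I E (TangentSpace I : M → Type _)}
    {J : Π x : M, TangentSpace I x →L[ℝ] TangentSpace I x} (hJ : IsKaehler cov J)
    {φ : N → M} {V : Π y : N, TangentSpace I (φ y)} {x : N}
    (hV : MDifferentiableAt K I.tangent (fun y => (⟨φ y, V y⟩ : TangentBundle I M)) x) :
    MDifferentiableAt K I.tangent (fun y => (⟨φ y, J (φ y) (V y)⟩ : TangentBundle I M)) x := by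
  have hφ : MDifferentiableAt K I φ x := by
    rw [mdifferentiableAt_totalSpace] at hV
    exact hV.1
  exact MDifferentiableAt.clm_bundle_apply (b := φ)
      (((hJ.smooth (φ x)).mdifferentiableAt (by simp)).comp x hφ) hV

end AlongMaps

/-! ### Symmetry of the covariant derivative of `dφ`. -/

section Symmetry

set_option linter.unusedSectionVars false

open Filter Topology

variable {E : Type*} [NormedAddCommGroup E] [NormedSpace ℝ E] [FiniteDimensional ℝ E]
  {H : Type*} [TopologicalSpace H] {I : ModelWithCorners ℝ E H}
  {M : Type*} [TopologicalSpace M] [ChartedSpace H M] [IsManifold I ∞ M]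
  {F : Type*} [NormedAddCommGroup F] [NormedSpace ℝ F] [FiniteDimensional ℝ F]
  {G : Type*} [TopologicalSpace G] {K : ModelWithCorners ℝ F G}
  {N : Type*} [TopologicalSpace N] [ChartedSpace G N] [IsManifold K ∞ N]

/-- Over the chart domain the trivialization is the derivative of the chart, so a field with
constant components is a constant field in coordinates. -/
lemma mpullbackWithin_constField {p : M} (a : E) {z : E} (hz : z ∈ (extChartAt I p).target) :
    VectorField.mpullbackWithin 𝓘(ℝ, E) I (extChartAt I p).symm (constField I p a)
      (Set.range I) z = a := by
  have hs : (extChartAt I p).symm z ∈ (chartAt H p).source := by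
    have := (extChartAt I p).map_target hz
    rwa [extChartAt_source] at this
  have := IsManifold.of_le (n := ∞) (m := 1) (I := I) (M := M) (by simp)
  rw [VectorField.mpullbackWithin_apply, constField, TangentBundle.symmL_trivializationAt hs,
    (extChartAt I p).right_inv hz]
  exact (isInvertible_mfderivWithin_extChartAt_symm hz).inverse_apply_eq.2 rfl

/-- Fields with constant components in a chart commute. -/
lemma mlieBracket_constField (p : M) (a b : E) :
    VectorField.mlieBracket I (constField I p a) (constField I p b) p = 0 := by
  rw [← VectorField.mlieBracketWithin_univ, VectorField.mlieBracketWithin_apply]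
  have h : ∀ c : E, VectorField.mpullbackWithin 𝓘(ℝ, E) I (extChartAt I p).symm (constField I p c)
      (Set.range I) =ᶠ[𝓝[(extChartAt I p).symm ⁻¹' Set.univ ∩ Set.range I] (extChartAt I p p)]
        fun _ => c := by
    intro c
    rw [Set.preimage_univ, Set.univ_inter]
    filter_upwards [extChartAt_target_mem_nhdsWithin p] with z hz
    exact mpullbackWithin_constField c hz
  have hp : extChartAt I p p ∈ (extChartAt I p).symm ⁻¹' Set.univ ∩ Set.range I :=
    ⟨trivial, ⟨_, rfl⟩⟩
  have h0 : VectorField.lieBracketWithin ℝ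
      (VectorField.mpullbackWithin 𝓘(ℝ, E) I (extChartAt I p).symm (constField I p a)
        (Set.range I))
      (VectorField.mpullbackWithin 𝓘(ℝ, E) I (extChartAt I p).symm (constField I p b)
        (Set.range I))
      ((extChartAt I p).symm ⁻¹' Set.univ ∩ Set.range I) (extChartAt I p p) = 0 := by
    refine ((h a).lieBracketWithin_vectorField_eq_of_mem (h b) hp).trans ?_
    simp [VectorField.lieBracketWithin]
  rw [h0]
  exact map_zero _

/-- Vanishing torsion together with a vanishing bracket: this is the symmetry of the Christoffel
symbols at the centre of the chart. -/
lemma IsLeviCivita.cov_constField_comm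
    [Bundle.RiemannianBundle (fun x : M => TangentSpace I x)]
    {cov : CovariantDerivative I E (TangentSpace I : M → Type _)} (hcov : IsLeviCivita cov)
    (p : M) (a b : E) :
    cov (constField I p b) p (constField I p a p) =
      cov (constField I p a) p (constField I p b p) := by
  have := (cov.torsion_eq_zero_iff.1 hcov.torsion_free) (mdifferentiableAt_constField p a)
    (mdifferentiableAt_constField p b)
  rwa [mlieBracket_constField, sub_eq_zero] at this

/-- In the trivialization at `x`, a tangent vector is represented by its image under the derivative
of the chart. -/
lemma snd_trivializationAt_eq_mfderiv_extChartAt {x y : M} (hy : y ∈ (chartAt H x).source)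
    (w : TangentSpace I y) :
    (trivializationAt E (TangentSpace I : M → Type _) x ⟨y, w⟩).2 =
      (mfderiv I 𝓘(ℝ, E) (extChartAt I x) y : E →L[ℝ] E) w := by
  have := IsManifold.of_le (n := ∞) (m := 1) (I := I) (M := M) (by simp)
  refine Eq.trans ?_ (congrArg (fun D : TangentSpace I y →L[ℝ] E => D w)
    (TangentBundle.continuousLinearMapAt_trivializationAt hy))
  change _ = (trivializationAt E (TangentSpace I : M → Type _) x).continuousLinearMapAt ℝ y w
  rw [Bundle.Trivialization.continuousLinearMapAt_apply,
    Bundle.Trivialization.linearMapAt_apply, if_pos (by simpa using hy)]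

lemma fderiv_eq_of_hasMFDerivAt {h : F → E} {z : F} {D : F →L[ℝ] E}
    (hD : HasMFDerivAt 𝓘(ℝ, F) 𝓘(ℝ, E) h z D) : fderiv ℝ h z = D :=
  HasFDerivAt.fderiv (𝕜 := ℝ) (E := F) (F := E) (f' := D) (hasMFDerivAt_iff_hasFDerivAt.1 hD)

/-- The components of `dφ V`, for a field `V` with constant components, are a derivative of `φ`
in charts. -/
lemma eventually_snd_mfderiv_extend [K.Boundaryless] {φ : N → M} (hφ : ContMDiff K I ∞ φ) (x : N)
    (v : TangentSpace K x) :
    (fun y => (trivializationAt E (TangentSpace I : M → Type _) (φ x)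
      ⟨φ y, mfderiv K I φ y (FiberBundle.extend F v y)⟩).2) =ᶠ[𝓝 x]
    fun y => fderiv ℝ (writtenInExtChartAt K I x φ) (extChartAt K x y)
      (trivializationAt F (TangentSpace K : N → Type _) x ⟨x, v⟩).2 := by
  have := IsManifold.of_le (n := ∞) (m := 1) (I := I) (M := M) (by simp)
  have := IsManifold.of_le (n := ∞) (m := 1) (I := K) (M := N) (by simp)
  have h₁ : ∀ᶠ y in 𝓝 x, y ∈ (chartAt G x).source := chart_source_mem_nhds G x
  have h₂ : ∀ᶠ y in 𝓝 x, φ y ∈ (chartAt H (φ x)).source :=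
    hφ.continuous.continuousAt.eventually (chart_source_mem_nhds H (φ x))
  filter_upwards [h₁, h₂, extend_eventuallyEq_constField v] with y hy hφy hv
  have hyt : extChartAt K x y ∈ (extChartAt K x).target :=
    (extChartAt K x).map_source (by rwa [extChartAt_source])
  have hinv : (extChartAt K x).symm (extChartAt K x y) = y :=
    (extChartAt K x).left_inv (by rwa [extChartAt_source])
  have e₁ : ∀ w : TangentSpace I (φ y),
      (trivializationAt E (TangentSpace I : M → Type _) (φ x) ⟨φ y, w⟩).2 =
        (mfderiv I 𝓘(ℝ, E) (extChartAt I (φ x)) (φ y) : E →L[ℝ] E) w := fun w =>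
    snd_trivializationAt_eq_mfderiv_extChartAt hφy w
  have e₂ : ∀ c : F, constField K x c y =
      (mfderiv 𝓘(ℝ, F) K (extChartAt K x).symm (extChartAt K x y) : F →L[ℝ] F) c := fun c => by
    rw [constField, TangentBundle.symmL_trivializationAt hy, K.range_eq_univ, mfderivWithin_univ]
    rfl
  have d₁ : HasMFDerivAt 𝓘(ℝ, F) K (extChartAt K x).symm (extChartAt K x y)
      (mfderiv 𝓘(ℝ, F) K (extChartAt K x).symm (extChartAt K x y)) := by
    have := mdifferentiableWithinAt_extChartAt_symm hyt
    rw [K.range_eq_univ, mdifferentiableWithinAt_univ] at this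
    exact this.hasMFDerivAt
  -- The chain rule asks for the derivative at the image of `y` under the chart and its inverse,
  -- which equals `y` only propositionally. Quantifying over `y'` avoids transport between tangent
  -- spaces.
  have d₂ : ∀ y', y' = y → HasMFDerivAt K I φ y' (mfderiv K I φ y : F →L[ℝ] E) := by
    rintro _ rfl
    exact (hφ.mdifferentiableAt (by simp)).hasMFDerivAt
  have d₃ : ∀ y', y' = y → HasMFDerivAt I 𝓘(ℝ, E) (extChartAt I (φ x)) (φ y')
      (mfderiv I 𝓘(ℝ, E) (extChartAt I (φ x)) (φ y) : E →L[ℝ] E) := by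
    rintro _ rfl
    exact (mdifferentiableAt_extChartAt hφy).hasMFDerivAt
  have d₁₂ : HasMFDerivAt 𝓘(ℝ, F) I (φ ∘ (extChartAt K x).symm) (extChartAt K x y) _ :=
    HasMFDerivAt.comp (extChartAt K x y) (d₂ _ hinv) d₁
  have d : HasMFDerivAt 𝓘(ℝ, F) 𝓘(ℝ, E) (writtenInExtChartAt K I x φ) (extChartAt K x y)
      ((mfderiv I 𝓘(ℝ, E) (extChartAt I (φ x)) (φ y) : E →L[ℝ] E) ∘L
        (mfderiv K I φ y : F →L[ℝ] E) ∘L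
          (mfderiv 𝓘(ℝ, F) K (extChartAt K x).symm (extChartAt K x y) : F →L[ℝ] F)) :=
    HasMFDerivAt.comp (f := φ ∘ (extChartAt K x).symm) (extChartAt K x y) (d₃ _ hinv) d₁₂
  rw [e₁, hv, e₂, fderiv_eq_of_hasMFDerivAt d]
  rfl

/-- The covariant derivative of `dφ V` along `φ` in the direction `U` is symmetric in `U` and `V`
for fields with constant components. -/
lemma IsLeviCivita.covAlong_mfderiv_extend_comm [K.Boundaryless]
    [Bundle.RiemannianBundle (fun x : M => TangentSpace I x)]
    {cov : CovariantDerivative I E (TangentSpace I : M → Type _)} (hcov : IsLeviCivita cov)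
    {φ : N → M} (hφ : ContMDiff K I ∞ φ) (x : N) (u v : TangentSpace K x) :
    covAlong K cov φ (fun y => mfderiv K I φ y (FiberBundle.extend F v y)) x u =
      covAlong K cov φ (fun y => mfderiv K I φ y (FiberBundle.extend F u y)) x v := by
  have hψ : MDifferentiableAt K 𝓘(ℝ, F) (extChartAt K x) x :=
    mdifferentiableAt_extChartAt (mem_chart_source G x)
  have hΦ : ContDiffAt ℝ 2 (writtenInExtChartAt K I x φ) (extChartAt K x x) := by
    have := (contMDiffAt_iff.1 ((hφ x).of_le (n := ∞) (m := 2) ENat.LEInfty.out)).2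
    rwa [K.range_eq_univ, contDiffWithinAt_univ] at this
  have hΦ' : DifferentiableAt ℝ (fderiv ℝ (writtenInExtChartAt K I x φ)) (extChartAt K x x) :=
    (hΦ.fderiv_right (m := 1) (by norm_num)).differentiableAt (by simp)
  have hsymm : IsSymmSndFDerivAt ℝ (writtenInExtChartAt K I x φ) (extChartAt K x x) :=
    hΦ.isSymmSndFDerivAt (by simp)
  -- At its own centre the preferred trivialization is the identity on the tangent space.
  have hid : ∀ w : TangentSpace K x,
      (trivializationAt F (TangentSpace K : N → Type _) x ⟨x, w⟩).2 = w := fun w =>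
    (tangentBundleCore K N).coordChange_self (achart G x) x (mem_chart_source G x) w
  -- The second term of `covAlong` is the second derivative of `φ` in charts; the constant component
  -- vector of `v` contributes nothing.
  have hd : ∀ u v : TangentSpace K x,
      mvfderiv K (fun y => (trivializationAt E (TangentSpace I : M → Type _) (φ x)
        ⟨φ y, mfderiv K I φ y (FiberBundle.extend F v y)⟩).2) x u =
      fderiv ℝ (fderiv ℝ (writtenInExtChartAt K I x φ)) (extChartAt K x x) u v := by
    intro u v
    have h := (hΦ'.hasFDerivAt.clm_apply (hasFDerivAt_const
      (trivializationAt F (TangentSpace K : N → Type _) x ⟨x, v⟩).2 _)).hasMFDerivAt.comp x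
        hψ.hasMFDerivAt
    rw [hid, mfderiv_extChartAt_self] at h
    have h' := eventually_snd_mfderiv_extend hφ x v
    rw [hid] at h'
    rw [mvfderiv_eq_of_hasMFDerivAt (h.congr_of_eventuallyEq h')]
    change fderiv ℝ (writtenInExtChartAt K I x φ) (extChartAt K x x) 0 + _ = _
    rw [map_zero, zero_add]
    rfl
  have hval : ∀ w : TangentSpace K x,
      mfderiv K I φ x (FiberBundle.extend F w x) = mfderiv K I φ x w := fun w => by
    rw [FiberBundle.extend_apply_self]
  unfold covAlong
  simp only [hval, cov_extend]
  rw [hd, hd, hsymm u v]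
  -- The second derivatives have been matched; the remaining terms are the Christoffel terms at `φ
  -- x`, applied to `dφ u` and `dφ v`.
  congr 1
  have := hcov.cov_constField_comm (φ x)
    (trivializationAt E (TangentSpace I : M → Type _) (φ x) ⟨φ x, mfderiv K I φ x u⟩).2
    (trivializationAt E (TangentSpace I : M → Type _) (φ x) ⟨φ x, mfderiv K I φ x v⟩).2
  rwa [constField_snd _ (mem_baseSet_self _), constField_snd _ (mem_baseSet_self _)] at this

end Symmetry

/-! ### Local extensions on a product, and pointwise Kaehler identities. -/

section WarpedProduct

set_option linter.unusedSectionVars false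

open Filter Topology

variable {E : Type*} [NormedAddCommGroup E] [NormedSpace ℝ E] [FiniteDimensional ℝ E]
  {H : Type*} [TopologicalSpace H] {I : ModelWithCorners ℝ E H}
  {M : Type*} [TopologicalSpace M] [ChartedSpace H M] [IsManifold I ∞ M]
  {E₁ : Type*} [NormedAddCommGroup E₁] [NormedSpace ℝ E₁] [FiniteDimensional ℝ E₁]
  {H₁ : Type*} [TopologicalSpace H₁] {I₁ : ModelWithCorners ℝ E₁ H₁}
  {A : Type*} [TopologicalSpace A] [ChartedSpace H₁ A] [IsManifold I₁ ∞ A]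
  {E₂ : Type*} [NormedAddCommGroup E₂] [NormedSpace ℝ E₂] [FiniteDimensional ℝ E₂]
  {H₂ : Type*} [TopologicalSpace H₂] {I₂ : ModelWithCorners ℝ E₂ H₂}
  {B : Type*} [TopologicalSpace B] [ChartedSpace H₂ B] [IsManifold I₂ ∞ B]

/-- The chart of a product is the product of the charts, so its derivative is block diagonal. -/
lemma snd_trivializationAt_tangentPair {x y : A × B} (h₁ : y.1 ∈ (chartAt H₁ x.1).source)
    (h₂ : y.2 ∈ (chartAt H₂ x.2).source) (a : TangentSpace I₁ y.1) (b : TangentSpace I₂ y.2) :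
    (trivializationAt (E₁ × E₂) (TangentSpace (I₁.prod I₂) : A × B → Type _) x
      ⟨y, tangentPair I₁ I₂ y a b⟩).2 =
      ((trivializationAt E₁ (TangentSpace I₁ : A → Type _) x.1 ⟨y.1, a⟩).2,
        (trivializationAt E₂ (TangentSpace I₂ : B → Type _) x.2 ⟨y.2, b⟩).2) := by
  have := IsManifold.of_le (n := ∞) (m := 1) (I := I₁) (M := A) (by simp)
  have := IsManifold.of_le (n := ∞) (m := 1) (I := I₂) (M := B) (by simp)
  have hy : y ∈ (chartAt (ModelProd H₁ H₂) x).source := by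
    rw [prodChartedSpace_chartAt]
    exact ⟨h₁, h₂⟩
  rw [snd_trivializationAt_eq_mfderiv_extChartAt hy, snd_trivializationAt_eq_mfderiv_extChartAt h₁,
    snd_trivializationAt_eq_mfderiv_extChartAt h₂]
  have h := (mdifferentiableAt_extChartAt (I := I₁) h₁).hasMFDerivAt.prodMap
    (mdifferentiableAt_extChartAt (I := I₂) h₂).hasMFDerivAt
  have e : ⇑(extChartAt (I₁.prod I₂) x) =
      Prod.map (extChartAt I₁ x.1) (extChartAt I₂ x.2) := by
    rw [extChartAt_prod]
    rfl
  rw [← modelWithCornersSelf_prod, chartedSpaceSelf_prod, ← e] at h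
  exact congrArg (fun D : TangentSpace (I₁.prod I₂) y →L[ℝ] E₁ × E₂ =>
    D (tangentPair I₁ I₂ y a b)) (mvfderiv_eq_of_hasMFDerivAt (X := E₁ × E₂) h)

/-- Both sides have the same components in the product trivialization. Consequently extensions of
vectors in `D` or `D^⊥` stay in that distribution near `x`, and the pointwise hypotheses on `φ` can
be differentiated. -/
lemma eventually_extend_tangentPair (x : A × B) (a : TangentSpace I₁ x.1)
    (b : TangentSpace I₂ x.2) :
    ∀ᶠ y in 𝓝 x,
      (FiberBundle.extend (E₁ × E₂) (tangentPair I₁ I₂ x a b) y : TangentSpace (I₁.prod I₂) y) =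
        tangentPair I₁ I₂ y (FiberBundle.extend E₁ a y.1) (FiberBundle.extend E₂ b y.2) := by
  have h₁ : ∀ᶠ y : A × B in 𝓝 x, y.1 ∈ (chartAt H₁ x.1).source :=
    continuous_fst.continuousAt.eventually (chart_source_mem_nhds H₁ x.1)
  have h₂ : ∀ᶠ y : A × B in 𝓝 x, y.2 ∈ (chartAt H₂ x.2).source :=
    continuous_snd.continuousAt.eventually (chart_source_mem_nhds H₂ x.2)
  filter_upwards [h₁, h₂] with y hy₁ hy₂
  have hy : y ∈ (trivializationAt (E₁ × E₂)
      (TangentSpace (I₁.prod I₂) : A × B → Type _) x).baseSet := by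
    rw [TangentBundle.trivializationAt_baseSet, prodChartedSpace_chartAt]
    exact ⟨hy₁, hy₂⟩
  have hb₁ : y.1 ∈ (trivializationAt E₁ (TangentSpace I₁ : A → Type _) x.1).baseSet := by
    simpa using hy₁
  have hb₂ : y.2 ∈ (trivializationAt E₂ (TangentSpace I₂ : B → Type _) x.2).baseSet := by
    simpa using hy₂
  rw [extend_eq_constField _ hy,
    snd_trivializationAt_tangentPair (mem_chart_source H₁ x.1) (mem_chart_source H₂ x.2),
    ← constField_snd (p := x) (tangentPair I₁ I₂ y (FiberBundle.extend E₁ a y.1)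
      (FiberBundle.extend E₂ b y.2)) hy, snd_trivializationAt_tangentPair hy₁ hy₂,
    extend_eq_constField a hb₁, extend_eq_constField b hb₂, snd_constField _ hb₁,
    snd_constField _ hb₂]

lemma eventually_extend_zero (x : M) :
    ∀ᶠ y in 𝓝 x, (FiberBundle.extend E (0 : TangentSpace I x) y : TangentSpace I y) = 0 := by
  filter_upwards [extend_eventuallyEq_constField (0 : TangentSpace I x)] with y hy
  have h0 : (trivializationAt E (TangentSpace I : M → Type _) x
      ⟨x, (0 : TangentSpace I x)⟩).2 = 0 := by
    rw [snd_trivializationAt_eq_mfderiv_extChartAt (mem_chart_source H x)]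
    exact map_zero _
  rw [hy, h0]
  exact map_zero _

lemma eventually_extend_tangentPair_left (x : A × B) (a : TangentSpace I₁ x.1) :
    ∀ᶠ y in 𝓝 x,
      (FiberBundle.extend (E₁ × E₂) (tangentPair I₁ I₂ x a 0) y : TangentSpace (I₁.prod I₂) y) =
        tangentPair I₁ I₂ y (FiberBundle.extend E₁ a y.1) 0 := by
  filter_upwards [eventually_extend_tangentPair (I₁ := I₁) (I₂ := I₂) x a 0,
    continuous_snd.continuousAt.eventually (eventually_extend_zero (I := I₂) x.2)] with y h₁ h₂
  rw [h₁, h₂]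

lemma eventually_extend_tangentPair_right (x : A × B) (b : TangentSpace I₂ x.2) :
    ∀ᶠ y in 𝓝 x,
      (FiberBundle.extend (E₁ × E₂) (tangentPair I₁ I₂ x 0 b) y : TangentSpace (I₁.prod I₂) y) =
        tangentPair I₁ I₂ y 0 (FiberBundle.extend E₂ b y.2) := by
  filter_upwards [eventually_extend_tangentPair (I₁ := I₁) (I₂ := I₂) x 0 b,
    continuous_fst.continuousAt.eventually (eventually_extend_zero (I := I₁) x.1)] with y h₁ h₂
  rw [h₁, h₂]

/-- The differential of a smooth map sends smooth local extensions to differentiable fields along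
the map. -/
lemma mdifferentiableAt_mfderiv_extend {φ : A → M} (hφ : ContMDiff I₁ I ∞ φ) (x : A)
    (v : TangentSpace I₁ x) :
    MDifferentiableAt I₁ I.tangent
      (fun y => (⟨φ y, mfderiv I₁ I φ y (FiberBundle.extend E₁ v y)⟩ : TangentBundle I M)) x := by
  have h : ContMDiff I₁.tangent I.tangent 1 (tangentMap I₁ I φ) :=
    hφ.contMDiff_tangentMap (by rw [one_add_one_eq_two]; exact ENat.LEInfty.out)
  exact (h.mdifferentiableAt (x := ⟨x, FiberBundle.extend E₁ v x⟩) one_ne_zero).comp x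
    (FiberBundle.mdifferentiableAt_extend I₁ E₁ v)

lemma mvfderiv_congr_of_eventuallyEq {g h : M → ℝ} {x : M} (hgh : g =ᶠ[𝓝 x] h) :
    mvfderiv I g x = mvfderiv I h x := by
  ext u
  exact congrArg (fun D : TangentSpace I x →L[ℝ] ℝ => D u) hgh.mfderiv_eq

lemma mvfderiv_eq_zero_of_eventually_eq_zero {h : M → ℝ} {x : M} (hh : ∀ᶠ y in 𝓝 x, h y = 0)
    (u : TangentSpace I x) : mvfderiv I h x u = 0 := by
  have : h =ᶠ[𝓝 x] fun _ => 0 := hh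
  rw [mvfderiv_congr_of_eventuallyEq this, mvfderiv_const]
  rfl

section Metric

variable [Bundle.RiemannianBundle (fun x : M => TangentSpace I x)]

lemma IsKaehler.covDerivEnd_eq_zero
    {cov : CovariantDerivative I E (TangentSpace I : M → Type _)}
    {J : Π x : M, TangentSpace I x →L[ℝ] TangentSpace I x} (hJ : IsKaehler cov J) (x : M)
    (u v : TangentSpace I x) : covDerivEnd cov J x u v = 0 :=
  sub_eq_zero.2 (hJ.parallel _ x (FiberBundle.mdifferentiableAt_extend I E v) u)

lemma IsKaehler.inner_left
    {cov : CovariantDerivative I E (TangentSpace I : M → Type _)}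
    {J : Π x : M, TangentSpace I x →L[ℝ] TangentSpace I x} (hJ : IsKaehler cov J) (x : M)
    (u v : TangentSpace I x) : inner ℝ u (J x v) = - inner ℝ (J x u) v := by
  rw [← hJ.hermitian, hJ.sq, inner_neg_right]

/-- Each summand is a projection of `(∇_Z J)X`, which vanishes because `J` is parallel. -/
lemma IsKaehler.normSqP_eq_zero
    {cov : CovariantDerivative I E (TangentSpace I : M → Type _)}
    {J : Π x : M, TangentSpace I x →L[ℝ] TangentSpace I x} (hJ : IsKaehler cov J)
    [Bundle.RiemannianBundle (fun x : A => TangentSpace I₁ x)]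
    [Bundle.RiemannianBundle (fun x : B => TangentSpace I₂ x)]
    (f : A → ℝ) (φ : A × B → M) (x : A × B) : normSqP I₁ I₂ cov J f φ x = 0 := by
  simp [normSqP, tangentialP, hJ.covDerivEnd_eq_zero]

lemma inner_grad (h : M → ℝ) (x : M) (u : TangentSpace I x) :
    inner ℝ (grad (I := I) h x) u = mvfderiv I h x u := by
  have : CompleteSpace (TangentSpace I x) := FiniteDimensional.complete ℝ _
  exact InnerProductSpace.toDual_symm_apply

/-- The covariant derivative of `dφ V` along `φ` at `x` in the direction `u`, where `V` is the local
extension of `v`. -/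
abbrev covMfderiv (cov : CovariantDerivative I E (TangentSpace I : M → Type _)) (φ : A → M) (x : A)
    (u v : TangentSpace I₁ x) : TangentSpace I (φ x) :=
  covAlong I₁ cov φ (fun y => mfderiv I₁ I φ y (FiberBundle.extend E₁ v y)) x u

/-- The second fundamental form and the full covariant derivative have the same inner products
with normal vectors. -/
lemma inner_secondFundamentalForm
    {cov : CovariantDerivative I E (TangentSpace I : M → Type _)} {φ : A → M} (x : A) (u v : TangentSpace I₁ x)
    {n : TangentSpace I (φ x)} (hn : n ∈ (tangentRange I₁ I φ x)ᗮ) :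
    inner ℝ (secondFundamentalForm I₁ cov φ x u v) n = inner ℝ (covMfderiv cov φ x u v) n := by
  unfold secondFundamentalForm
  rw [Submodule.inner_starProjection_left_eq_right, Submodule.starProjection_eq_self_iff.2 hn]

end Metric

end WarpedProduct

/-! ### The mixed second fundamental form and the estimate. -/

section Inequality

set_option linter.unusedSectionVars false

open Filter Topology

variable {E : Type*} [NormedAddCommGroup E] [NormedSpace ℝ E] [FiniteDimensional ℝ E]
  {H : Type*} [TopologicalSpace H] {I : ModelWithCorners ℝ E H}
  {M : Type*} [TopologicalSpace M] [ChartedSpace H M] [IsManifold I ∞ M]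
  [Bundle.RiemannianBundle (fun x : M => TangentSpace I x)]
  [IsContMDiffRiemannianBundle I ∞ E (fun x : M => TangentSpace I x)]
  {E₁ : Type*} [NormedAddCommGroup E₁] [NormedSpace ℝ E₁] [FiniteDimensional ℝ E₁]
  {H₁ : Type*} [TopologicalSpace H₁] {I₁ : ModelWithCorners ℝ E₁ H₁}
  {A : Type*} [TopologicalSpace A] [ChartedSpace H₁ A] [IsManifold I₁ ∞ A]
  [Bundle.RiemannianBundle (fun x : A => TangentSpace I₁ x)]
  {E₂ : Type*} [NormedAddCommGroup E₂] [NormedSpace ℝ E₂] [FiniteDimensional ℝ E₂]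
  {H₂ : Type*} [TopologicalSpace H₂] {I₂ : ModelWithCorners ℝ E₂ H₂}
  {B : Type*} [TopologicalSpace B] [ChartedSpace H₂ B] [IsManifold I₂ ∞ B]
  [Bundle.RiemannianBundle (fun x : B => TangentSpace I₂ x)]
  [IsContMDiffRiemannianBundle I₂ ∞ E₂ (fun x : B => TangentSpace I₂ x)]
  {cov : CovariantDerivative I E (TangentSpace I : M → Type _)}
  {J : Π x : M, TangentSpace I x →L[ℝ] TangentSpace I x}
  {f : A → ℝ} {φ : A × B → M}

/-- The derivative of `f² g_B(Z, Z)` in the direction of a vector tangent to `A`. -/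
lemma mvfderiv_warped_inner (hf : MDifferentiable I₁ 𝓘(ℝ, ℝ) f) (x : A × B)
    (u : TangentSpace I₁ x.1) (b : TangentSpace I₂ x.2) :
    mvfderiv (I₁.prod I₂)
      (fun y : A × B => f y.1 ^ 2 * (inner ℝ (FiberBundle.extend E₂ b y.2 : TangentSpace I₂ y.2)
        (FiberBundle.extend E₂ b y.2 : TangentSpace I₂ y.2))) x (tangentPair I₁ I₂ x u 0) =
      2 * f x.1 * mvfderiv I₁ f x.1 u * inner ℝ b b := by
  have hb : MDifferentiableAt I₂ 𝓘(ℝ, ℝ)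
      (fun z : B => (inner ℝ (FiberBundle.extend E₂ b z : TangentSpace I₂ z)
        (FiberBundle.extend E₂ b z : TangentSpace I₂ z) : ℝ)) x.2 :=
    mdifferentiableAt_inner (φ := fun z : B => z) (FiberBundle.mdifferentiableAt_extend I₂ E₂ b)
      (FiberBundle.mdifferentiableAt_extend I₂ E₂ b)
  have hf2 : MDifferentiableAt I₁ 𝓘(ℝ, ℝ) (fun a => f a * f a) x.1 := (hf x.1).mul (hf x.1)
  have h₁ : MDifferentiableAt (I₁.prod I₂) 𝓘(ℝ, ℝ) (fun y : A × B => f y.1 * f y.1) x :=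
    hf2.comp x mdifferentiableAt_fst
  have h₂ : MDifferentiableAt (I₁.prod I₂) 𝓘(ℝ, ℝ)
      (fun y : A × B => (inner ℝ (FiberBundle.extend E₂ b y.2 : TangentSpace I₂ y.2)
        (FiberBundle.extend E₂ b y.2 : TangentSpace I₂ y.2) : ℝ)) x :=
    hb.comp x mdifferentiableAt_snd
  have d₁ : mvfderiv (I₁.prod I₂) (fun y : A × B => f y.1 * f y.1) x (tangentPair I₁ I₂ x u 0) =
      2 * f x.1 * mvfderiv I₁ f x.1 u := by
    refine (mvfderiv_comp_apply x hf2 mdifferentiableAt_fst _).trans ?_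
    rw [mfderiv_fst, mvfderiv_fun_mul (hf x.1) (hf x.1)]
    change f x.1 * mvfderiv I₁ f x.1 u + f x.1 * mvfderiv I₁ f x.1 u = _
    ring
  have d₂ : mvfderiv (I₁.prod I₂)
      (fun y : A × B => (inner ℝ (FiberBundle.extend E₂ b y.2 : TangentSpace I₂ y.2)
        (FiberBundle.extend E₂ b y.2 : TangentSpace I₂ y.2) : ℝ)) x (tangentPair I₁ I₂ x u 0) =
      0 := by
    refine (mvfderiv_comp_apply x hb mdifferentiableAt_snd _).trans ?_
    rw [mfderiv_snd]
    exact map_zero _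
  simp only [pow_two]
  rw [mvfderiv_fun_mul h₁ h₂, add_apply, smul_apply, smul_apply, d₁, d₂,
    FiberBundle.extend_apply_self]
  simp only [smul_eq_mul]
  ring

/-- A Koszul-type computation. Orthogonality of `D` and `D^⊥` gives `g(∇_Z Z, X) = -g(Z, ∇_Z X)`;
since `∇_Z X = ∇_X Z`, the latter is `-½ X(g(Z, Z))`, and `g(Z, Z) = f² g_B(Z, Z)` varies along `A`
only through `f`. -/
lemma IsCRWarpedProduct.inner_covMfderiv_perp_perp [I₁.Boundaryless] [I₂.Boundaryless]
    (hφ : IsCRWarpedProduct I₁ I₂ J f φ) (hcov : IsLeviCivita cov) (x : A × B)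
    (u : TangentSpace I₁ x.1) (b : TangentSpace I₂ x.2) :
    inner ℝ (covMfderiv cov φ x (tangentPair I₁ I₂ x 0 b) (tangentPair I₁ I₂ x 0 b))
        (mfderiv (I₁.prod I₂) I φ x (tangentPair I₁ I₂ x u 0)) =
      - (f x.1 * mvfderiv I₁ f x.1 u * inner ℝ b b) := by
  have hX := mdifferentiableAt_mfderiv_extend hφ.smooth x (tangentPair I₁ I₂ x u 0)
  have hZ := mdifferentiableAt_mfderiv_extend hφ.smooth x (tangentPair I₁ I₂ x 0 b)
  have e₁ := hcov.mvfderiv_inner_along hZ hX (tangentPair I₁ I₂ x 0 b)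
  have e₂ := hcov.mvfderiv_inner_along hZ hZ (tangentPair I₁ I₂ x u 0)
  -- Replacing `∇_X Z` by `∇_Z X` makes both identities involve the same term `g(Z, ∇_Z X)`, which
  -- is eliminated at the end.
  rw [hcov.covAlong_mfderiv_extend_comm hφ.smooth x (tangentPair I₁ I₂ x u 0)
    (tangentPair I₁ I₂ x 0 b)] at e₂
  have g₁ : ∀ᶠ y in 𝓝 x, inner ℝ
      (mfderiv (I₁.prod I₂) I φ y
        (FiberBundle.extend (E₁ × E₂) (tangentPair I₁ I₂ x 0 b) y))
      (mfderiv (I₁.prod I₂) I φ y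
        (FiberBundle.extend (E₁ × E₂) (tangentPair I₁ I₂ x u 0) y)) = 0 := by
    filter_upwards [eventually_extend_tangentPair_left (I₁ := I₁) (I₂ := I₂) x u,
      eventually_extend_tangentPair_right (I₁ := I₁) (I₂ := I₂) x b] with y h₁ h₂
    rw [h₁, h₂, hφ.isometric]
    simp
  have g₂ : (fun y => inner ℝ
      (mfderiv (I₁.prod I₂) I φ y
        (FiberBundle.extend (E₁ × E₂) (tangentPair I₁ I₂ x 0 b) y))
      (mfderiv (I₁.prod I₂) I φ y
        (FiberBundle.extend (E₁ × E₂) (tangentPair I₁ I₂ x 0 b) y))) =ᶠ[𝓝 x]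
      fun y : A × B => f y.1 ^ 2 *
        (inner ℝ (FiberBundle.extend E₂ b y.2 : TangentSpace I₂ y.2)
          (FiberBundle.extend E₂ b y.2 : TangentSpace I₂ y.2)) := by
    filter_upwards [eventually_extend_tangentPair_right (I₁ := I₁) (I₂ := I₂) x b] with y h₂
    rw [h₂, hφ.isometric]
    simp
  have g₂' := mvfderiv_warped_inner (I₂ := I₂)
    (hφ.warp_smooth.mdifferentiable (by simp)) x u b
  rw [mvfderiv_eq_zero_of_eventually_eq_zero g₁] at e₁
  rw [mvfderiv_congr_of_eventuallyEq g₂, g₂'] at e₂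
  simp only [FiberBundle.extend_apply_self] at e₁ e₂
  have c := real_inner_comm (mfderiv (I₁.prod I₂) I φ x (tangentPair I₁ I₂ x 0 b))
    (covMfderiv cov φ x (tangentPair I₁ I₂ x 0 b) (tangentPair I₁ I₂ x u 0))
  unfold covMfderiv at c ⊢
  linarith

/-- Anti-invariance makes `g(X, JZ)` vanish near `x`. Its derivative along `Z` gives `g(∇_Z X, JZ) =
-g(X, J ∇_Z Z) = g(JX, ∇_Z Z)`, and `JX` lies in `D`, so the preceding formula applies to it. -/
lemma IsCRWarpedProduct.inner_covMfderiv_perp_left [I₁.Boundaryless] [I₂.Boundaryless]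
    (hφ : IsCRWarpedProduct I₁ I₂ J f φ) (hJ : IsKaehler cov J) (x : A × B)
    {u u' : TangentSpace I₁ x.1} (b : TangentSpace I₂ x.2)
    (hu : J (φ x) (mfderiv (I₁.prod I₂) I φ x (tangentPair I₁ I₂ x u 0)) =
      mfderiv (I₁.prod I₂) I φ x (tangentPair I₁ I₂ x u' 0)) :
    inner ℝ (covMfderiv cov φ x (tangentPair I₁ I₂ x 0 b) (tangentPair I₁ I₂ x u 0))
        (J (φ x) (mfderiv (I₁.prod I₂) I φ x (tangentPair I₁ I₂ x 0 b))) =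
      - (f x.1 * mvfderiv I₁ f x.1 u' * inner ℝ b b) := by
  have hX := mdifferentiableAt_mfderiv_extend hφ.smooth x (tangentPair I₁ I₂ x u 0)
  have hZ := mdifferentiableAt_mfderiv_extend hφ.smooth x (tangentPair I₁ I₂ x 0 b)
  have e := hJ.leviCivita.mvfderiv_inner_along hX (hJ.mdifferentiableAt_comp hZ)
    (tangentPair I₁ I₂ x 0 b)
  have g : ∀ᶠ y in 𝓝 x, inner ℝ
      (mfderiv (I₁.prod I₂) I φ y
        (FiberBundle.extend (E₁ × E₂) (tangentPair I₁ I₂ x u 0) y))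
      (J (φ y) (mfderiv (I₁.prod I₂) I φ y
        (FiberBundle.extend (E₁ × E₂) (tangentPair I₁ I₂ x 0 b) y))) = 0 := by
    filter_upwards [eventually_extend_tangentPair_right (I₁ := I₁) (I₂ := I₂) x b] with y hy
    rw [hy]
    exact (Submodule.mem_orthogonal _ _).1 (hφ.anti_invariant y _) _ ⟨_, rfl⟩
  rw [mvfderiv_eq_zero_of_eventually_eq_zero g, hJ.covAlong_comp hZ] at e
  simp only [FiberBundle.extend_apply_self] at e
  rw [hJ.inner_left _ (mfderiv (I₁.prod I₂) I φ x (tangentPair I₁ I₂ x u 0)), hu, real_inner_comm _ (mfderiv (I₁.prod I₂) I φ x (tangentPair I₁ I₂ x u' 0))] at e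
  have h := hφ.inner_covMfderiv_perp_perp hJ.leviCivita x u' b
  unfold covMfderiv at h ⊢
  linarith

lemma IsCRWarpedProduct.norm_mfderiv_framePerp (hφ : IsCRWarpedProduct I₁ I₂ J f φ) (x : A × B)
    (α : Fin (Module.finrank ℝ (TangentSpace I₂ x.2))) :
    ‖mfderiv (I₁.prod I₂) I φ x (framePerp I₁ I₂ f x α)‖ = 1 := by
  have hpos := hφ.warp_pos x.1
  have h := hφ.isometric x 0 0 ((f x.1)⁻¹ • stdOrthonormalBasis ℝ (TangentSpace I₂ x.2) α)
    ((f x.1)⁻¹ • stdOrthonormalBasis ℝ (TangentSpace I₂ x.2) α)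
  rw [real_inner_self_eq_norm_sq, real_inner_smul_left, real_inner_smul_right,
    inner_zero_left, real_inner_self_eq_norm_sq,
    (stdOrthonormalBasis ℝ (TangentSpace I₂ x.2)).norm_eq_one] at h
  have h' : ‖mfderiv (I₁.prod I₂) I φ x (framePerp I₁ I₂ f x α)‖ ^ 2 = 1 := by
    refine h.trans ?_
    field_simp
    ring
  exact (pow_eq_one_iff_of_nonneg (norm_nonneg _) two_ne_zero).1 h'

lemma IsKaehler.norm_map (hJ : IsKaehler cov J) (x : M) (u : TangentSpace I x) :
    ‖J x u‖ = ‖u‖ := by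
  have h := hJ.hermitian x u u
  rw [real_inner_self_eq_norm_sq, real_inner_self_eq_norm_sq] at h
  exact (pow_left_inj₀ (norm_nonneg _) (norm_nonneg _) two_ne_zero).1 h

/-- Since `g(ω(Z, X), JZ) = -(JX)(log f)` for a unit vector `Z` of the frame of `D^⊥`, the norm of
`ω(Z, X)` bounds the derivative of `log f` in the direction `JX`. -/
lemma IsCRWarpedProduct.sq_inner_grad_le [I₁.Boundaryless] [I₂.Boundaryless]
    (hφ : IsCRWarpedProduct I₁ I₂ J f φ) (hJ : IsKaehler cov J) (x : A × B)
    {u u' : TangentSpace I₁ x.1} (α : Fin (Module.finrank ℝ (TangentSpace I₂ x.2)))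
    (hu : J (φ x) (mfderiv (I₁.prod I₂) I φ x (tangentPair I₁ I₂ x u 0)) =
      mfderiv (I₁.prod I₂) I φ x (tangentPair I₁ I₂ x u' 0)) :
    (inner ℝ (grad (I := I₁) (fun a => Real.log (f a)) x.1) u') ^ 2 ≤
      ‖secondFundamentalForm (I₁.prod I₂) cov φ x (framePerp I₁ I₂ f x α)
        (tangentPair I₁ I₂ x u 0)‖ ^ 2 := by
  have hpos := hφ.warp_pos x.1
  have hlog : mvfderiv I₁ (fun a => Real.log (f a)) x.1 u' = (f x.1)⁻¹ * mvfderiv I₁ f x.1 u' := by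
    have hf : HasMFDerivAt I₁ 𝓘(ℝ, ℝ) f x.1 (mvfderiv I₁ f x.1) :=
      (hφ.warp_smooth.mdifferentiableAt (by simp)).hasMFDerivAt
    have h := (Real.hasDerivAt_log hpos.ne').hasFDerivAt.hasMFDerivAt.comp x.1 hf
    rw [show (fun a => Real.log (f a)) = Real.log ∘ f from rfl, mvfderiv_eq_of_hasMFDerivAt h]
    change mvfderiv I₁ f x.1 u' * (f x.1)⁻¹ = _
    ring
  have h₁ := hφ.inner_covMfderiv_perp_left hJ x
    ((f x.1)⁻¹ • stdOrthonormalBasis ℝ (TangentSpace I₂ x.2) α) hu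
  -- `JZ` is normal, so it sees only the `ω` part of `∇_Z X`. With `Z` scaled by `f⁻¹`, the factor
  -- `f g_B(Z, Z)` becomes `f⁻¹`, which produces `log f`.
  rw [← inner_secondFundamentalForm _ _ _ (hφ.anti_invariant x _), real_inner_smul_left,
    real_inner_smul_right, real_inner_self_eq_norm_sq,
    (stdOrthonormalBasis ℝ (TangentSpace I₂ x.2)).norm_eq_one] at h₁
  have h₂ := abs_real_inner_le_norm
    (secondFundamentalForm (I₁.prod I₂) cov φ x (framePerp I₁ I₂ f x α) (tangentPair I₁ I₂ x u 0))
    (J (φ x) (mfderiv (I₁.prod I₂) I φ x (framePerp I₁ I₂ f x α)))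
  rw [hJ.norm_map, hφ.norm_mfderiv_framePerp, mul_one] at h₂
  refine le_trans (le_of_eq ?_) (pow_le_pow_left₀ (abs_nonneg _) h₂ 2)
  unfold framePerp
  rw [sq_abs, h₁, inner_grad, hlog]
  field_simp

/-- `J` maps the frame of `D` to an orthonormal frame of `D`. -/
lemma IsCRWarpedProduct.exists_orthonormalBasis (hφ : IsCRWarpedProduct I₁ I₂ J f φ)
    (hJ : IsKaehler cov J) (x : A × B) :
    ∃ e : OrthonormalBasis (Fin (Module.finrank ℝ (TangentSpace I₁ x.1))) ℝ (TangentSpace I₁ x.1),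
      ∀ i, J (φ x) (mfderiv (I₁.prod I₂) I φ x (frameD I₁ I₂ x i)) =
        mfderiv (I₁.prod I₂) I φ x (tangentPair I₁ I₂ x (e i) 0) := by
  choose e he using fun i => hφ.invariant x (stdOrthonormalBasis ℝ (TangentSpace I₁ x.1) i)
  -- Both `J` and `dφ` restricted to `TA` preserve inner products.
  have hinner : ∀ i j, inner ℝ (e i) (e j) = inner ℝ
      (stdOrthonormalBasis ℝ (TangentSpace I₁ x.1) i)
      (stdOrthonormalBasis ℝ (TangentSpace I₁ x.1) j) := fun i j => by
    have h₁ := hφ.isometric x (e i) (e j) 0 0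
    have h₂ := hφ.isometric x (stdOrthonormalBasis ℝ (TangentSpace I₁ x.1) i)
      (stdOrthonormalBasis ℝ (TangentSpace I₁ x.1) j) 0 0
    rw [← he, ← he, hJ.hermitian, h₂] at h₁
    simpa using h₁.symm
  have hon : Orthonormal ℝ e := by
    classical
    rw [orthonormal_iff_ite]
    intro i j
    rw [hinner, OrthonormalBasis.inner_eq_ite]
  refine ⟨OrthonormalBasis.mk hon ?_, fun i => ?_⟩
  · rw [hon.linearIndependent.span_eq_top_of_card_eq_finrank' (Fintype.card_fin _)]
  · rw [OrthonormalBasis.coe_mk]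
    exact he i

/-- Only the block `ω(Z_α, X_i)` is kept. For each `α`, Parseval in the basis `J X_i` bounds its row
below by `‖grad log f‖²`. -/
theorem IsCRWarpedProduct.finrank_mul_norm_grad_sq_le [I₁.Boundaryless] [I₂.Boundaryless]
    (hφ : IsCRWarpedProduct I₁ I₂ J f φ) (hJ : IsKaehler cov J) (x : A × B) :
    (Module.finrank ℝ (TangentSpace I₂ x.2) : ℝ) *
        ‖grad (I := I₁) (fun a => Real.log (f a)) x.1‖ ^ 2 ≤ normSqω I₁ I₂ cov f φ x := by
  obtain ⟨e, he⟩ := hφ.exists_orthonormalBasis hJ x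
  unfold normSqω
  rw [Fintype.sum_sum_type]
  -- All terms with first argument in `D` are dropped, including the transposed copy `ω(X_i, Z_α)`
  -- of the mixed block.
  refine le_trans ?_ (le_add_of_nonneg_left
    (Finset.sum_nonneg fun _ _ => Finset.sum_nonneg fun _ _ => sq_nonneg _))
  rw [← e.sum_sq_inner_right, ← nsmul_eq_mul]
  refine le_trans (le_of_eq ?_) (Finset.card_nsmul_le_sum Finset.univ _
    (∑ i, inner ℝ (e i) (grad (I := I₁) (fun a => Real.log (f a)) x.1) ^ 2) fun α _ => ?_)
  · rw [Finset.card_univ, Fintype.card_fin]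
  · rw [Fintype.sum_sum_type]
    refine le_trans (Finset.sum_le_sum fun i _ => ?_) (le_add_of_nonneg_right
      (Finset.sum_nonneg fun _ _ => sq_nonneg _))
    rw [real_inner_comm]
    exact hφ.sq_inner_grad_le hJ x α (he i)

end Inequality

end CRWarped

end

theorem theorem3 {m k q : ℕ}
    {M : Type*} [TopologicalSpace M] [ChartedSpace (EuclideanSpace ℝ (Fin (2 * m))) M]
    [IsManifold (𝓡 (2 * m)) ∞ M]
    [Bundle.RiemannianBundle (fun x : M => TangentSpace (𝓡 (2 * m)) x)]
    [IsContMDiffRiemannianBundle (𝓡 (2 * m)) ∞ (EuclideanSpace ℝ (Fin (2 * m)))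
      (fun x : M => TangentSpace (𝓡 (2 * m)) x)]
    {WT : Type*} [TopologicalSpace WT] [ChartedSpace (EuclideanSpace ℝ (Fin k)) WT]
    [IsManifold (𝓡 k) ∞ WT]
    [Bundle.RiemannianBundle (fun x : WT => TangentSpace (𝓡 k) x)]
    [IsContMDiffRiemannianBundle (𝓡 k) ∞ (EuclideanSpace ℝ (Fin k))
      (fun x : WT => TangentSpace (𝓡 k) x)]
    {WP : Type*} [TopologicalSpace WP] [ChartedSpace (EuclideanSpace ℝ (Fin q)) WP]
    [IsManifold (𝓡 q) ∞ WP]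
    [Bundle.RiemannianBundle (fun x : WP => TangentSpace (𝓡 q) x)]
    [IsContMDiffRiemannianBundle (𝓡 q) ∞ (EuclideanSpace ℝ (Fin q))
      (fun x : WP => TangentSpace (𝓡 q) x)]
    (cov : CovariantDerivative (𝓡 (2 * m)) (EuclideanSpace ℝ (Fin (2 * m)))
      (TangentSpace (𝓡 (2 * m)) : M → Type _))
    (J : Π x : M, TangentSpace (𝓡 (2 * m)) x →L[ℝ] TangentSpace (𝓡 (2 * m)) x)
    (hM : CRWarped.IsBochnerKaehler m cov J)
    (f : WT → ℝ) (φ : WT × WP → M)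
    (hφ : CRWarped.IsCRWarpedProduct (𝓡 k) (𝓡 q) J f φ)
    (hP : CRWarped.PMapsIntoD (𝓡 k) (𝓡 q) cov J φ) (x : WT × WP) :
    CRWarped.normSqω (𝓡 k) (𝓡 q) cov f φ x ≥
      CRWarped.normSqP (𝓡 k) (𝓡 q) cov J f φ x
        + (q : ℝ) * ‖CRWarped.grad (I := 𝓡 k) (fun a => Real.log (f a)) x.1‖ ^ 2 := by
  rw [hM.normSqP_eq_zero, zero_add, ge_iff_le]
  have h := hφ.finrank_mul_norm_grad_sq_le hM.toIsKaehler x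
  rwa [show Module.finrank ℝ (TangentSpace (𝓡 q) x.2) = q from finrank_euclideanSpace_fin] at h
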